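/- Let $E_0,E_1$ be complex Banach spaces such that $E_1$ is continuously and densely embedded in $E_0$, and let $A:E_1\to E_0$ be a bounded linear operator which, regarded as an unbounded operator on $E_0$ with domain $D(A)=E_1$, is closed. Let $J=[0,T]$ with $0<T<\infty$, or $J=\mathbb R_+=[0,\infty)$. Let $\mathbb E_0(J)=BUC(J,E_0)$ be the space of bounded uniformly continuous functions $J\to E_0$ and $\mathbb E_1(J)=BUC^1(J,E_0)\cap BUC(J,E_1)$ the space of all $u\in BUC(J,E_1)$ that are continuously differentiable as $E_0$-valued functions with $u,\dot u\in BUC(J,E_0)$; both carry their natural norms built from suprema. Let $\gamma:\mathbb E_1(J)\to E_0$, $\gamma u=u(0)$, and let $\gamma\mathbb E_1$ be the range of $\gamma$, with the norm $\|x\|_\gamma=\inf\{\|u\|_{\mathbb E_1(J)}:u\in\mathbb E_1(J),\ \gamma u=x\}$. Suppose that $(\mathbb E_0(J),\mathbb E_1(J))$ is a pair of continuous maximal regularity for $A$, that is, $\big(\tfrac{d}{dt}-A,\gamma\big)$ is a (topological linear) isomorphism from $\mathbb E_1(J)$ onto $\mathbb E_0(J)\times\gamma\mathbb E_1$: for every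 $(f,x)\in\mathbb E_0(J)\times\gamma\mathbb E_1$ there is a unique $u\in\mathbb E_1(J)$ with $\dot u(t)-Au(t)=f(t)$ for $t\in J$ and $u(0)=x$, and the map $(f,x)\mapsto u$ is continuous. Then $A$, with domain $D(A)=E_1$, is the infinitesimal generator of a strongly continuous analytic semigroup on $E_0$. Moreover, if $J=\mathbb R_+$, then the spectral bound $s(A)=\sup\{\operatorname{Re}\mu:\mu\in\sigma(A)\}\in[-\infty,\infty]$ (with $\sup\emptyset=-\infty$) satisfies $s(A)<0$. -/

import Mathlib

open Set Filter Topology BoundedContinuousFunction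
open scoped NNReal

namespace ContMaxReg

noncomputable section

/-! ### Unbounded operators -/

section Operators

variable {E₀ E₁ : Type*} [NormedAddCommGroup E₀] [NormedSpace ℂ E₀]
  [NormedAddCommGroup E₁] [NormedSpace ℂ E₁]

/-- Given an embedding `i : E₁ → E₀` and `A : E₁ → E₀`, the operator `A` regarded as an unbounded
operator on `E₀` with domain (the image of) `E₁`. -/
def realization (i : E₁ →L[ℂ] E₀) (hi : Function.Injective i) (A : E₁ →L[ℂ] E₀) :
    E₀ →ₗ.[ℂ] E₀ where
  domain := LinearMap.range (i : E₁ →ₗ[ℂ] E₀)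
  toFun := (A : E₁ →ₗ[ℂ] E₀) ∘ₗ
    ((LinearEquiv.ofInjective (i : E₁ →ₗ[ℂ] E₀) hi).symm :
      LinearMap.range (i : E₁ →ₗ[ℂ] E₀) →ₗ[ℂ] E₁)

theorem realization_apply (i : E₁ →L[ℂ] E₀) (hi : Function.Injective i) (A : E₁ →L[ℂ] E₀)
    (x : E₁) : realization i hi A ⟨i x, ⟨x, rfl⟩⟩ = A x := by
  have h : (LinearEquiv.ofInjective (i : E₁ →ₗ[ℂ] E₀) hi).symm ⟨i x, ⟨x, rfl⟩⟩ = x := by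
    rw [LinearEquiv.symm_apply_eq]
    rfl
  exact congrArg A h

/-- The resolvent set of an unbounded operator `B`: those `μ` for which `μ - B : D(B) → E₀` has a
bounded (everywhere defined) two-sided inverse. -/
def unboundedResolventSet (B : E₀ →ₗ.[ℂ] E₀) : Set ℂ :=
  {μ | ∃ R : E₀ →L[ℂ] E₀,
    (∀ x : B.domain, R (μ • (x : E₀) - B x) = x) ∧
    ∀ y : E₀, ∃ h : R y ∈ B.domain, μ • R y - B ⟨R y, h⟩ = y}

/-- The spectrum of an unbounded operator. -/
def unboundedSpectrum (B : E₀ →ₗ.[ℂ] E₀) : Set ℂ :=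
  (unboundedResolventSet B)ᶜ

/-- The spectral bound `sup {Re μ : μ ∈ σ(B)}`, an extended real number
(it is `-∞` if the spectrum is empty). -/
def spectralBound (B : E₀ →ₗ.[ℂ] E₀) : EReal :=
  sSup ((fun μ : ℂ => (μ.re : EReal)) '' unboundedSpectrum B)

/-- Strongly continuous one-parameter semigroups of bounded operators. -/
structure IsC0Semigroup (S : ℝ≥0 → E₀ →L[ℂ] E₀) : Prop where
  map_zero : S 0 = 1
  map_add : ∀ s t : ℝ≥0, S (s + t) = S s * S t
  strongly_continuous : ∀ x : E₀, Continuous fun t : ℝ≥0 => S t x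

/-- `B` is the infinitesimal generator of `S`: `x ∈ D(B)` and `B x = y` if and only if
`(S t x - x) / t → y` as `t → 0+`. -/
def IsInfinitesimalGenerator (B : E₀ →ₗ.[ℂ] E₀) (S : ℝ≥0 → E₀ →L[ℂ] E₀) : Prop :=
  ∀ x y : E₀, (x, y) ∈ B.graph ↔
    Tendsto (fun t : ℝ≥0 => (t : ℝ)⁻¹ • (S t x - x)) (𝓝[>] 0) (𝓝 y)

/-- The open sector `{z ≠ 0 : |arg z| < θ}`. -/
def sector (θ : ℝ) : Set ℂ := {z | z ≠ 0 ∧ |z.arg| < θ}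

/-- The semigroup `S` is (strongly continuous) analytic: for some angle `0 < θ ≤ π / 2` it has a
holomorphic extension to the sector of angle `θ`, which satisfies the semigroup law and is strongly
continuous at `0` in each strictly smaller sector. -/
def IsAnalyticSemigroup (S : ℝ≥0 → E₀ →L[ℂ] E₀) : Prop :=
  ∃ θ : ℝ, 0 < θ ∧ θ ≤ Real.pi / 2 ∧ ∃ Z : ℂ → E₀ →L[ℂ] E₀,
    (∀ t : ℝ≥0, Z ((t : ℝ) : ℂ) = S t) ∧
    DifferentiableOn ℂ Z (sector θ) ∧
    (∀ z ∈ sector θ, ∀ w ∈ sector θ, Z (z + w) = Z z * Z w) ∧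
    ∀ θ' : ℝ, 0 < θ' → θ' < θ → ∀ x : E₀, Tendsto (fun z => Z z x) (𝓝[sector θ'] 0) (𝓝 x)

/-- `B` generates a strongly continuous analytic semigroup. -/
def GeneratesAnalyticSemigroup (B : E₀ →ₗ.[ℂ] E₀) : Prop :=
  ∃ S : ℝ≥0 → E₀ →L[ℂ] E₀,
    IsC0Semigroup S ∧ IsInfinitesimalGenerator B S ∧ IsAnalyticSemigroup S

end Operators

/-! ### Spaces of bounded uniformly continuous functions -/

section Spaces

/-- `BUC(J, E)`, the bounded uniformly continuous functions `J → E`, with the supremum norm. -/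
def BUC (J : Set ℝ) (E : Type*) [NormedAddCommGroup E] [NormedSpace ℂ E] :
    Submodule ℂ (J →ᵇ E) where
  carrier := {u | UniformContinuous (u : J → E)}
  add_mem' := fun hu hv => UniformContinuous.add hu hv
  zero_mem' := uniformContinuous_const
  smul_mem' := fun c _ hu => UniformContinuous.const_smul hu c

/-- `v` is the derivative of `u : J → E` (one-sided at end points belonging to `J`): some function
on the line that extends `u` has derivative `v t` within `J` at each `t ∈ J`. -/
def HasDerivOn {J : Set ℝ} {E : Type*} [NormedAddCommGroup E] [NormedSpace ℂ E]
    (u v : J → E) : Prop :=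
  ∃ U : ℝ → E, (∀ t : J, U t = u t) ∧ ∀ t : J, HasDerivWithinAt U (v t) J t

/-- `BUC¹(J, E)`: the pairs `(u, u')` with `u` and its derivative `u'` in `BUC(J, E)`. When `J` is
a nondegenerate interval `u'` is determined by `u`. The norm is `max (sup ‖u‖) (sup ‖u'‖)`. -/
def BUC1 (J : Set ℝ) (E : Type*) [NormedAddCommGroup E] [NormedSpace ℂ E] :
    Submodule ℂ ((J →ᵇ E) × (J →ᵇ E)) where
  carrier := {p | p.1 ∈ BUC J E ∧ p.2 ∈ BUC J E ∧ HasDerivOn (p.1 : J → E) (p.2 : J → E)}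
  add_mem' := by
    rintro p q ⟨hp, hp', U, hU, hU'⟩ ⟨hq, hq', V, hV, hV'⟩
    exact ⟨add_mem hp hq, add_mem hp' hq', U + V,
      fun t => congrArg₂ (· + ·) (hU t) (hV t), fun t => (hU' t).add (hV' t)⟩
  zero_mem' := ⟨zero_mem _, zero_mem _, 0, fun _ => rfl,
    fun t => hasDerivWithinAt_const (t : ℝ) J 0⟩
  smul_mem' := by
    rintro c p ⟨hp, hp', U, hU, hU'⟩
    exact ⟨Submodule.smul_mem _ c hp, Submodule.smul_mem _ c hp', c • U,
      fun t => congrArg (c • ·) (hU t), fun t => (hU' t).const_smul c⟩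

variable {E₀ E₁ : Type*} [NormedAddCommGroup E₀] [NormedSpace ℂ E₀]
  [NormedAddCommGroup E₁] [NormedSpace ℂ E₁]

/-- The intersection `BUC¹(J, E₀) ∩ BUC(J, E₁)`, for `E₁` embedded in `E₀` by `i`: pairs of an
element `(u, u')` of `BUC¹(J, E₀)` and an element `w` of `BUC(J, E₁)` such that `u` and `w` are the
same function. The norm is the maximum of the two norms. -/
def SolSpace (i : E₁ →L[ℂ] E₀) (J : Set ℝ) :
    Submodule ℂ (((J →ᵇ E₀) × (J →ᵇ E₀)) × (J →ᵇ E₁)) where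
  carrier := {p | p.1 ∈ BUC1 J E₀ ∧ p.2 ∈ BUC J E₁ ∧ ∀ t : J, p.1.1 t = i (p.2 t)}
  add_mem' := by
    rintro p q ⟨hp, hp', h⟩ ⟨hq, hq', k⟩
    exact ⟨add_mem hp hq, add_mem hp' hq',
      fun t => (congrArg₂ (· + ·) (h t) (k t)).trans (map_add i _ _).symm⟩
  zero_mem' := ⟨zero_mem _, zero_mem _, fun _ => (map_zero i).symm⟩
  smul_mem' := by
    rintro c p ⟨hp, hp', h⟩
    exact ⟨Submodule.smul_mem _ c hp, Submodule.smul_mem _ c hp',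
      fun t => (congrArg (c • ·) (h t)).trans (map_smul i c _).symm⟩

/-- The derivative `d/dt : BUC¹(J, E₀) ∩ BUC(J, E₁) → BUC(J, E₀)`. -/
def derivMap (i : E₁ →L[ℂ] E₀) (J : Set ℝ) : SolSpace i J →L[ℂ] BUC J E₀ :=
  (((ContinuousLinearMap.snd ℂ (J →ᵇ E₀) (J →ᵇ E₀)).comp
    (ContinuousLinearMap.fst ℂ ((J →ᵇ E₀) × (J →ᵇ E₀)) (J →ᵇ E₁))).comp
      (SolSpace i J).subtypeL).codRestrict (BUC J E₀) (fun u => u.2.1.2.1)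

/-- The inclusion `BUC¹(J, E₀) ∩ BUC(J, E₁) → BUC(J, E₁)`. -/
def toE₁ (i : E₁ →L[ℂ] E₀) (J : Set ℝ) : SolSpace i J →L[ℂ] BUC J E₁ :=
  ((ContinuousLinearMap.snd ℂ ((J →ᵇ E₀) × (J →ᵇ E₀)) (J →ᵇ E₁)).comp
    (SolSpace i J).subtypeL).codRestrict (BUC J E₁) (fun u => u.2.2.1)

/-- Pointwise application of `A`, as a map `BUC(J, E₁) → BUC(J, E₀)`. -/
def applyOp (A : E₁ →L[ℂ] E₀) (J : Set ℝ) : BUC J E₁ →L[ℂ] BUC J E₀ :=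
  ((A.compLeftContinuousBounded J).comp (BUC J E₁).subtypeL).codRestrict (BUC J E₀)
    (fun u => A.uniformContinuous.comp u.2)

/-- The operator `d/dt - A : BUC¹(J, E₀) ∩ BUC(J, E₁) → BUC(J, E₀)`. -/
def evolutionOp (i A : E₁ →L[ℂ] E₀) (J : Set ℝ) : SolSpace i J →L[ℂ] BUC J E₀ :=
  derivMap i J - (applyOp A J).comp (toE₁ i J)

theorem evolutionOp_apply (i A : E₁ →L[ℂ] E₀) (J : Set ℝ) (u : SolSpace i J) (t : J) :
    (evolutionOp i A J u).1 t = u.1.1.2 t - A (u.1.2 t) := rfl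

/-- The trace operator `γ u = u(0) ∈ E₀`. -/
def trace (i : E₁ →L[ℂ] E₀) (J : Set ℝ) (h0 : (0 : ℝ) ∈ J) : SolSpace i J →ₗ[ℂ] E₀ where
  toFun u := u.1.1.1 ⟨0, h0⟩
  map_add' _ _ := rfl
  map_smul' _ _ := rfl

/-- The norm of the trace space (the range of `γ`): `‖x‖ = inf {‖u‖ : γ u = x}`. -/
def traceNorm (i : E₁ →L[ℂ] E₀) (J : Set ℝ) (h0 : (0 : ℝ) ∈ J) (x : E₀) : ℝ :=
  sInf {r : ℝ | ∃ u : SolSpace i J, trace i J h0 u = x ∧ r = ‖u‖}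

/-- `(BUC(J, E₀), BUC¹(J, E₀) ∩ BUC(J, E₁))` is a pair of (continuous) maximal regularity for `A`:
the map `(d/dt - A, γ)` into the product of `BUC(J, E₀)` and the trace space is an isomorphism, that
is, for every `f` and every `x` in the trace space there is a unique `u` with `u' - A u = f` and
`γ u = x`, and `u` depends continuously (boundedly) on `(f, x)`. (The map `(d/dt - A, γ)` itself is
always bounded.) -/
def IsPairOfContMaxReg (i A : E₁ →L[ℂ] E₀) (J : Set ℝ) (h0 : (0 : ℝ) ∈ J) : Prop :=
  (∀ f : BUC J E₀, ∀ x ∈ LinearMap.range (trace i J h0),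
    ∃! u : SolSpace i J, evolutionOp i A J u = f ∧ trace i J h0 u = x) ∧
  ∃ C : ℝ, ∀ u : SolSpace i J,
    ‖u‖ ≤ C * (‖evolutionOp i A J u‖ + traceNorm i J h0 (trace i J h0 u))

end Spaces

end

end ContMaxReg

/-! Only one consequence of maximal regularity is used (`MaxRegOn`): for data `f` in `BUC` and `x`
in `E₁` there is a solution of `u' = A u + f`, `u 0 = x`, and `‖u t‖ ≤ C (sup ‖f‖ + ‖u 0‖)` in the
norm of `E₁`. On the half line it passes to every `[0, T]` with the same `C`.

Resolvent (`MaxRegOn.bijective`). Take a scalar `H` with `H' = μ H + g`, `H 0 = 0`, and let `u`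
solve `u' = A u + g y`, `u 0 = 0`. Then `v = H y - u` satisfies `v' = μ v + (μ - A) u`, so Duhamel's
formula puts `v T = H T y - u T` in the range of `μ - A`. Since `‖u T‖ ≤ C ‖i‖ sup |g| ‖y‖` in `E₀`,
a Neumann series gives surjectivity once `C ‖i‖ sup |g| < |H T|`; the same inequality excludes
eigenvectors. With `g = 1` some large real `μ` qualifies. With `g = exp (μ t)`, `H = t exp (μ t)`
and `T > C ‖i‖`, all `μ` with `Re μ > -δ` qualify, whence the negative spectral bound.

Generation. The homogeneous problem defines a semigroup `S` on `E₁`. Conjugation by `L = μ - A`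
gives a strongly continuous semigroup `S₀` on `E₀`; it extends `S` because the resolvent commutes
with `S` (`IsExtendedFamily.apply_incl`).

Analyticity. The function `t S(t) x` solves the problem with right-hand side `S(t) x` and initial
value `0`, so `t ‖S(t) x‖` in `E₁` is at most a constant times `‖x‖` in `E₀`
(`IsExtendedFamily.smoothing`). Thus `t ‖A S₀(t)‖` is bounded near `0`. Factoring the `n`-th
derivative through `n` first derivatives makes the Taylor radius of `S₀` at `t` at least
proportional to `t`, and the Taylor series glue to an extension on a sector
(`IsDiffSemigroup.exists_extension`). -/

namespace ContMaxReg

/-! ### Strict solutions, and maximal regularity as solvability with an estimate in `E₁` -/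

section Solutions

variable {E₀ E₁ : Type*} [NormedAddCommGroup E₀] [NormedSpace ℂ E₀]
  [NormedAddCommGroup E₁] [NormedSpace ℂ E₁]

/-- `u` is a (strict) solution of `u' = A u + f` on `J`. -/
structure IsSolOn (i A : E₁ →L[ℂ] E₀) (J : Set ℝ) (f : ℝ → E₀) (u : ℝ → E₁) : Prop where
  continuousOn : ContinuousOn u J
  hasDeriv : ∀ t ∈ J, HasDerivWithinAt (fun s => i (u s)) (A (u t) + f t) J t

variable {i A : E₁ →L[ℂ] E₀} {J K : Set ℝ} {f g : ℝ → E₀} {u v : ℝ → E₁}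

theorem IsSolOn.mono (h : IsSolOn i A J f u) (hK : K ⊆ J) : IsSolOn i A K f u :=
  ⟨h.continuousOn.mono hK, fun t ht => (h.hasDeriv t (hK ht)).mono hK⟩

theorem IsSolOn.congr (h : IsSolOn i A J f u) (hg : EqOn g f J) (hv : EqOn v u J) :
    IsSolOn i A J g v := by
  refine ⟨h.continuousOn.congr hv, fun t ht => ?_⟩
  rw [hv ht, hg ht]
  exact (h.hasDeriv t ht).congr (fun s hs => by rw [hv hs]) (by rw [hv ht])

theorem IsSolOn.sub (hu : IsSolOn i A J f u) (hv : IsSolOn i A J g v) :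
    IsSolOn i A J (f - g) (u - v) := by
  refine ⟨hu.continuousOn.sub hv.continuousOn, fun t ht => ?_⟩
  have := (hu.hasDeriv t ht).sub (hv.hasDeriv t ht)
  convert this using 1
  · ext s; simp
  · simp only [Pi.sub_apply, map_sub]; abel

theorem IsSolOn.add (hu : IsSolOn i A J f u) (hv : IsSolOn i A J g v) :
    IsSolOn i A J (f + g) (u + v) := by
  refine ⟨hu.continuousOn.add hv.continuousOn, fun t ht => ?_⟩
  have := (hu.hasDeriv t ht).add (hv.hasDeriv t ht)
  convert this using 1
  · ext s; simp
  · simp only [Pi.add_apply, map_add]; abel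

theorem IsSolOn.const_smul (c : ℂ) (hu : IsSolOn i A J f u) :
    IsSolOn i A J (c • f) (c • u) := by
  refine ⟨hu.continuousOn.const_smul c, fun t ht => ?_⟩
  have := (hu.hasDeriv t ht).const_smul c
  convert this using 1
  · ext s; simp
  · simp only [Pi.smul_apply, map_smul, smul_add]

theorem IsSolOn.comp_add_const (h : IsSolOn i A J f u) (a : ℝ) (hK : ∀ t ∈ K, t + a ∈ J) :
    IsSolOn i A K (fun t => f (t + a)) (fun t => u (t + a)) := by
  refine ⟨h.continuousOn.comp (by fun_prop) hK, fun t ht => ?_⟩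
  have := (h.hasDeriv (t + a) (hK t ht)).scomp t ((hasDerivWithinAt_id t K).add_const a) hK
  simpa [Function.comp_def] using this

theorem eqOn_ite_left {X : Type*} {τ : ℝ} (hJ : J ⊆ Iic τ) (a b : ℝ → X) :
    EqOn (fun t => if t ≤ τ then a t else b t) a J :=
  fun _ ht => if_pos (hJ ht)

theorem eqOn_ite_right {X : Type*} {τ : ℝ} (hK : K ⊆ Ici τ) {a b : ℝ → X} (hab : a τ = b τ) :
    EqOn (fun t => if t ≤ τ then a t else b t) b K := by
  intro t ht
  rcases eq_or_lt_of_le (show τ ≤ t from hK ht) with rfl | h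
  · simp [hab]
  · simp [not_le.2 h]

theorem IsSolOn.glue {τ : ℝ} (hu : IsSolOn i A J f u) (hv : IsSolOn i A K g v)
    (hJ : J ⊆ Iic τ) (hK : K ⊆ Ici τ) (hτJ : τ ∈ J) (hτK : τ ∈ K)
    (huv : u τ = v τ) (hfg : f τ = g τ) :
    IsSolOn i A (J ∪ K) (fun t => if t ≤ τ then f t else g t)
      (fun t => if t ≤ τ then u t else v t) := by
  have hu' := hu.congr (eqOn_ite_left hJ f g) (eqOn_ite_left hJ u v)
  have hv' := hv.congr (eqOn_ite_right hK hfg) (eqOn_ite_right hK huv)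
  -- Only `τ` can be adherent to both pieces, and it lies in both. At any other point of one piece,
  -- continuity and differentiability within the other piece are vacuous.
  have nJ {t : ℝ} (htK : t ∈ K) (ht : t ∉ J) : t ∉ closure J := fun h' =>
    ht (le_antisymm (mem_Iic.1 (closure_minimal hJ isClosed_Iic h')) (mem_Ici.1 (hK htK)) ▸ hτJ)
  have nK {t : ℝ} (htJ : t ∈ J) (ht : t ∉ K) : t ∉ closure K := fun h' =>
    ht (le_antisymm (mem_Iic.1 (hJ htJ)) (mem_Ici.1 (closure_minimal hK isClosed_Ici h')) ▸ hτK)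
  refine ⟨fun t ht => ContinuousWithinAt.union ?_ ?_, fun t ht => HasDerivWithinAt.union ?_ ?_⟩
  · by_cases h : t ∈ J
    · exact hu'.continuousOn t h
    · exact continuousWithinAt_of_notMem_closure (nJ (ht.resolve_left h) h)
  · by_cases h : t ∈ K
    · exact hv'.continuousOn t h
    · exact continuousWithinAt_of_notMem_closure (nK (ht.resolve_right h) h)
  · by_cases h : t ∈ J
    · exact hu'.hasDeriv t h
    · exact HasFDerivWithinAt.of_notMem_closure (nJ (ht.resolve_left h) h)
  · by_cases h : t ∈ K
    · exact hv'.hasDeriv t h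
    · exact HasFDerivWithinAt.of_notMem_closure (nK (ht.resolve_right h) h)

/-- Bounded and uniformly continuous on `J`. -/
def IsBUCOn {E : Type*} [NormedAddCommGroup E] (J : Set ℝ) (u : ℝ → E) : Prop :=
  UniformContinuousOn u J ∧ ∃ c, ∀ t ∈ J, ‖u t‖ ≤ c

section
variable {E : Type*} [NormedAddCommGroup E] {w z : ℝ → E}

theorem IsBUCOn.congr (h : IsBUCOn J w) (hz : EqOn z w J) : IsBUCOn J z := by
  refine ⟨h.1.congr hz.symm, h.2.imp fun c hc t ht => ?_⟩
  rw [hz ht]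
  exact hc t ht

theorem isBUCOn_of_isCompact (hJ : IsCompact J) (h : ContinuousOn w J) : IsBUCOn J w :=
  ⟨hJ.uniformContinuousOn_of_continuous h, hJ.exists_bound_of_continuousOn h⟩

theorem isBUCOn_const (c : E) : IsBUCOn J fun _ => c :=
  ⟨uniformContinuous_const.uniformContinuousOn, ‖c‖, fun _ _ => le_rfl⟩

theorem IsBUCOn.comp_sub_const (h : IsBUCOn J w) (a : ℝ) (hK : ∀ t ∈ K, t - a ∈ J) :
    IsBUCOn K fun t => w (t - a) :=
  ⟨h.1.comp (uniformContinuous_id.sub uniformContinuous_const).uniformContinuousOn hK,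
    h.2.imp fun _ hc t ht => hc _ (hK t ht)⟩

theorem IsBUCOn.glue {τ : ℝ} (hw : IsBUCOn J w) (hz : IsBUCOn K z)
    (hJ : J ⊆ Iic τ) (hK : K ⊆ Ici τ) (hτJ : τ ∈ J) (hτK : τ ∈ K) (hwz : w τ = z τ) :
    IsBUCOn (J ∪ K) (fun t => if t ≤ τ then w t else z t) := by
  have hw' := hw.congr (eqOn_ite_left hJ w z)
  have hz' := hz.congr (eqOn_ite_right hK hwz)
  set y := fun t => if t ≤ τ then w t else z t
  refine ⟨?_, ?_⟩
  · rw [Metric.uniformContinuousOn_iff]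
    intro ε hε
    obtain ⟨δ₁, h₁, H₁⟩ := Metric.uniformContinuousOn_iff.1 hw'.1 (ε / 2) (by positivity)
    obtain ⟨δ₂, h₂, H₂⟩ := Metric.uniformContinuousOn_iff.1 hz'.1 (ε / 2) (by positivity)
    -- Points on opposite sides are compared through the junction `τ`, which costs `ε / 2` on each
    -- side.
    have key : ∀ s ∈ J, ∀ t ∈ K, dist s t < min δ₁ δ₂ → dist (y s) (y t) < ε := by
      intro s hs t ht hst
      have hsτ : s ≤ τ := hJ hs
      have hτt : τ ≤ t := hK ht
      rw [lt_min_iff, Real.dist_eq, abs_sub_comm, abs_of_nonneg (by linarith)] at hst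
      have e₁ := H₁ s hs τ hτJ (by
        rw [Real.dist_eq, abs_sub_comm, abs_of_nonneg (by linarith)]; linarith)
      have e₂ := H₂ τ hτK t ht (by
        rw [Real.dist_eq, abs_sub_comm, abs_of_nonneg (by linarith)]; linarith)
      linarith [dist_triangle (y s) (y τ) (y t)]
    refine ⟨min δ₁ δ₂, lt_min h₁ h₂, fun s hs t ht hst => ?_⟩
    rcases hs with hs | hs <;> rcases ht with ht | ht
    · linarith [H₁ s hs t ht (hst.trans_le (min_le_left _ _))]
    · exact key s hs t ht hst
    · rw [dist_comm]
      exact key t ht s hs (by rwa [dist_comm])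
    · linarith [H₂ s hs t ht (hst.trans_le (min_le_right _ _))]
  · obtain ⟨c, hc⟩ := hw'.2
    obtain ⟨d, hd⟩ := hz'.2
    refine ⟨max c d, fun t ht => ?_⟩
    rcases ht with ht | ht
    · exact (hc t ht).trans (le_max_left _ _)
    · exact (hd t ht).trans (le_max_right _ _)

theorem IsBUCOn.glue_Ici {T : ℝ} (hT : 0 ≤ T) (hw : IsBUCOn (Icc 0 T) w)
    (hz : IsBUCOn (Ici T) z) (hwz : w T = z T) :
    IsBUCOn (Ici 0) (fun t => if t ≤ T then w t else z t) := by
  rw [← Icc_union_Ici_eq_Ici hT]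
  exact hw.glue hz (fun t ht => ht.2) le_rfl (right_mem_Icc.2 hT) self_mem_Ici hwz

end

/-- Solvability of `u' = A u + f`, `u 0 = x` on `J` in the class of bounded uniformly continuous
functions, with an estimate. -/
structure MaxRegOn (i A : E₁ →L[ℂ] E₀) (J : Set ℝ) (C : ℝ) : Prop where
  nonneg : 0 ≤ C
  exists_sol : ∀ f : ℝ → E₀, IsBUCOn J f → ∀ x : E₁, ∃ u, IsSolOn i A J f u ∧ IsBUCOn J u ∧ u 0 = x
  bound : ∀ (f : ℝ → E₀) (u : ℝ → E₁) (m : ℝ), IsBUCOn J f → IsBUCOn J u → IsSolOn i A J f u →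
    (∀ t ∈ J, ‖f t‖ ≤ m) → ∀ t ∈ J, ‖u t‖ ≤ C * (m + ‖u 0‖)

theorem exists_mem_buc {E : Type*} [NormedAddCommGroup E] [NormedSpace ℂ E] {w : ℝ → E}
    (hw : IsBUCOn J w) : ∃ b ∈ BUC J E, ∀ t : J, b t = w t := by
  obtain ⟨h, c, hc⟩ := hw
  have h' : UniformContinuous (J.domRestrict w) := uniformContinuousOn_iff_restrict.1 h
  exact ⟨BoundedContinuousFunction.ofNormedAddCommGroup (J.domRestrict w) h'.continuous c
    fun t => hc t t.2, h', fun t => rfl⟩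

theorem isBUCOn_of_mem_buc {E : Type*} [NormedAddCommGroup E] [NormedSpace ℂ E] {w : ℝ → E}
    {b : J →ᵇ E} (hb : b ∈ BUC J E) (h : ∀ t : J, w t = b t) : IsBUCOn J w := by
  refine ⟨uniformContinuousOn_iff_restrict.2 ?_, ‖b‖, fun t ht => ?_⟩
  · have : J.domRestrict w = b := funext h
    rw [this]
    exact hb
  · rw [h ⟨t, ht⟩]
    exact b.norm_coe_le_norm _

theorem exists_solSpace (h0 : (0 : ℝ) ∈ J) (hf : IsBUCOn J f) (hu : IsBUCOn J u)
    (h : IsSolOn i A J f u) : ∃ p : SolSpace i J, (∀ t : J, p.1.2 t = u t) ∧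
      (∀ t : J, (evolutionOp i A J p).1 t = f t) ∧ trace i J h0 p = i (u 0) := by
  obtain ⟨b, hb, hbu⟩ := exists_mem_buc hu
  obtain ⟨c, hc, hcf⟩ := exists_mem_buc hf
  let a := i.compLeftContinuousBounded J b
  have ha : a ∈ BUC J E₀ := i.uniformContinuous.comp hb
  let d := A.compLeftContinuousBounded J b + c
  have hd : d ∈ BUC J E₀ := add_mem (A.uniformContinuous.comp hb) hc
  refine ⟨⟨((a, d), b), ⟨ha, hd, fun s => i (u s), fun t => ?_, fun t => ?_⟩, hb, fun t => rfl⟩,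
    hbu, fun t => ?_, ?_⟩
  · simp [a, hbu]
  · have := h.hasDeriv t t.2
    simpa [d, hbu, hcf] using this
  · rw [evolutionOp_apply]
    simp [d, hcf]
  · simp [trace, a, hbu]

theorem exists_isSolOn (p : SolSpace i J) (hf : ∀ t : J, (evolutionOp i A J p).1 t = f t) :
    ∃ u : ℝ → E₁, (∀ t : J, u t = p.1.2 t) ∧ IsBUCOn J u ∧ IsSolOn i A J f u := by
  classical
  let u : ℝ → E₁ := fun t => if h : t ∈ J then p.1.2 ⟨t, h⟩ else 0
  have hu : ∀ t : J, u t = p.1.2 t := fun t => by simp [u]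
  have hb := isBUCOn_of_mem_buc p.2.2.1 hu
  refine ⟨u, hu, hb, hb.1.continuousOn, fun t ht => ?_⟩
  obtain ⟨-, -, U, hU, hU'⟩ := p.2.1
  have e : ∀ s ∈ J, i (u s) = U s := fun s hs => by
    rw [hU ⟨s, hs⟩, hu ⟨s, hs⟩, p.2.2.2]
  have hv : A (u t) + f t = p.1.1.2 ⟨t, ht⟩ := by
    have := hf ⟨t, ht⟩
    rw [evolutionOp_apply] at this
    rw [← this, hu ⟨t, ht⟩]
    abel
  rw [hv]
  exact (hU' ⟨t, ht⟩).congr e (e t ht)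

/-- Constant functions embed `E₁` boundedly into the trace space. -/
theorem exists_const_solSpace (h0 : (0 : ℝ) ∈ J) (x : E₁) :
    ∃ p : SolSpace i J, trace i J h0 p = i x ∧ ‖p‖ ≤ (‖i‖ + 1) * ‖x‖ := by
  refine ⟨⟨((BoundedContinuousFunction.const J (i x), 0), BoundedContinuousFunction.const J x),
    ⟨uniformContinuous_const, uniformContinuous_const, fun _ => i x, fun t => rfl,
      fun t => hasDerivWithinAt_const _ _ _⟩, uniformContinuous_const, fun t => rfl⟩, rfl, ?_⟩
  have h1 := BoundedContinuousFunction.norm_const_le (α := J) (i x)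
  have h2 := BoundedContinuousFunction.norm_const_le (α := J) x
  have h3 := i.le_opNorm x
  have h4 : 0 ≤ ‖i‖ * ‖x‖ := by positivity
  have h5 := norm_nonneg x
  refine max_le (max_le ?_ ?_) ?_
  · exact h1.trans (by linarith)
  · exact (norm_zero (E := J →ᵇ E₀)).le.trans (by linarith)
  · exact h2.trans (by linarith)

theorem traceNorm_nonneg (h0 : (0 : ℝ) ∈ J) (x : E₀) : 0 ≤ traceNorm i J h0 x :=
  Real.sInf_nonneg (by rintro _ ⟨u, -, rfl⟩; exact norm_nonneg u)

theorem traceNorm_le (h0 : (0 : ℝ) ∈ J) (x : E₁) :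
    traceNorm i J h0 (i x) ≤ (‖i‖ + 1) * ‖x‖ := by
  obtain ⟨p, hp, hp'⟩ := exists_const_solSpace (i := i) h0 x
  refine le_trans (csInf_le ⟨0, ?_⟩ ⟨p, hp, rfl⟩) hp'
  rintro _ ⟨u, -, rfl⟩
  exact norm_nonneg u

/-- Initial values are restricted to `E₁`, where the trace norm is dominated by the `E₁` norm; of
the norm of the solution space only the supremum in `E₁` is kept. -/
theorem IsPairOfContMaxReg.maxRegOn (h0 : (0 : ℝ) ∈ J) (hi : Function.Injective i)
    (h : IsPairOfContMaxReg i A J h0) : ∃ C, MaxRegOn i A J C := by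
  obtain ⟨hex, C, hC⟩ := h
  refine ⟨|C| * (‖i‖ + 1), by positivity, fun f hf x => ?_, fun f u m hf hu hs hm t ht => ?_⟩
  · obtain ⟨b, hb, hbf⟩ := exists_mem_buc hf
    obtain ⟨q, hq, -⟩ := exists_const_solSpace (i := i) h0 x
    obtain ⟨p, ⟨hp, hp'⟩, -⟩ := hex ⟨b, hb⟩ (i x) ⟨q, hq⟩
    obtain ⟨u, hu, hu', hs⟩ := exists_isSolOn (A := A) (f := f) p (fun t => by rw [hp]; exact hbf t)
    refine ⟨u, hs, hu', hi ?_⟩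
    rw [hu ⟨0, h0⟩, ← hp', ← p.2.2.2]
    rfl
  · obtain ⟨p, hp, hp', hp''⟩ := exists_solSpace h0 hf hu hs
    have h1 := hC p
    rw [hp''] at h1
    have hm0 : 0 ≤ m := (norm_nonneg _).trans (hm 0 h0)
    have h2 : ‖evolutionOp i A J p‖ ≤ m :=
      (BoundedContinuousFunction.norm_le hm0).2 fun t => (hp' t).symm ▸ hm t t.2
    have h3 := traceNorm_le (i := i) h0 (u 0)
    have h4 : ‖u t‖ ≤ ‖p‖ := by
      rw [← hp ⟨t, ht⟩]
      exact (p.1.2.norm_coe_le_norm _).trans (le_max_right _ _)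
    have h5 := traceNorm_nonneg (i := i) h0 (i (u 0))
    calc ‖u t‖ ≤ C * (‖evolutionOp i A J p‖ + traceNorm i J h0 (i (u 0))) := h4.trans h1
      _ ≤ |C| * (‖evolutionOp i A J p‖ + traceNorm i J h0 (i (u 0))) :=
        mul_le_mul_of_nonneg_right (le_abs_self C) (by positivity)
      _ ≤ |C| * ((‖i‖ + 1) * m + (‖i‖ + 1) * ‖u 0‖) := by
        gcongr
        have := mul_nonneg (norm_nonneg i) hm0
        linarith
      _ = _ := by ring

theorem MaxRegOn.bound_Icc {T C m : ℝ} (h : MaxRegOn i A (Icc 0 T) C)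
    (hf : ContinuousOn f (Icc 0 T)) (hu : IsSolOn i A (Icc 0 T) f u)
    (hm : ∀ t ∈ Icc 0 T, ‖f t‖ ≤ m) : ∀ t ∈ Icc 0 T, ‖u t‖ ≤ C * (m + ‖u 0‖) :=
  h.bound f u m (isBUCOn_of_isCompact isCompact_Icc hf)
    (isBUCOn_of_isCompact isCompact_Icc hu.continuousOn) hu hm

theorem MaxRegOn.exists_Icc {T C : ℝ} (h : MaxRegOn i A (Icc 0 T) C)
    (hf : ContinuousOn f (Icc 0 T)) (x : E₁) : ∃ u, IsSolOn i A (Icc 0 T) f u ∧ u 0 = x := by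
  obtain ⟨u, h1, -, h2⟩ := h.exists_sol f (isBUCOn_of_isCompact isCompact_Icc hf) x
  exact ⟨u, h1, h2⟩

/-- Maximal regularity on the half line implies maximal regularity on bounded intervals, with the
same constant. -/
theorem MaxRegOn.Icc_of_Ici {C : ℝ} (h : MaxRegOn i A (Ici 0) C) {T : ℝ} (hT : 0 < T) :
    MaxRegOn i A (Icc 0 T) C := by
  refine ⟨h.nonneg, fun f hf x => ?_, fun f u m hf hu hs hm t ht => ?_⟩
  -- The right-hand side is continued by the constant `f T`, which preserves both uniform continuity
  -- and the bound `m`.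
  · obtain ⟨u, hu, hu', hx⟩ := h.exists_sol _ (hf.glue_Ici hT.le (isBUCOn_const (f T)) rfl) x
    have := hu.mono (K := Icc 0 T) fun t ht => ht.1
    refine ⟨u, this.congr (eqOn_ite_left (fun t ht => ht.2) _ _).symm fun t _ => rfl, ?_, hx⟩
    exact isBUCOn_of_isCompact isCompact_Icc this.continuousOn
  -- To apply the half-line estimate, `u` is continued past `T` by the solution starting at `u T`
  -- with right-hand side `f T`.
  · obtain ⟨v, hv, hv', hx⟩ := h.exists_sol _ (isBUCOn_const (f T)) (u T)
    have hmem : ∀ t ∈ Ici T, t - T ∈ Ici (0 : ℝ) := fun t ht => mem_Ici.2 (sub_nonneg.2 ht)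
    have hv'' := hv.comp_add_const (-T) (K := Ici T) hmem
    have := hs.glue hv'' (fun t ht => ht.2) le_rfl (right_mem_Icc.2 hT.le) self_mem_Ici
      (by simp [hx]) rfl
    rw [Icc_union_Ici_eq_Ici hT.le] at this
    have := h.bound _ _ m (hf.glue_Ici hT.le (isBUCOn_const (f T)) rfl)
      (hu.glue_Ici hT.le (hv'.comp_sub_const T hmem) (by simp [hx])) this ?_ t ht.1
    · simpa [ht.2, hT.le] using this
    · intro s hs
      by_cases hsT : s ≤ T
      · simpa [hsT] using hm s ⟨hs, hsT⟩
      · simpa [hsT] using hm T (right_mem_Icc.2 hT.le)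

end Solutions

/-! ### Invertibility of `μ - A` and the spectral bound -/

section Resolvent

variable {E₀ E₁ : Type*} [NormedAddCommGroup E₀] [NormedSpace ℂ E₀]
  [NormedAddCommGroup E₁] [NormedSpace ℂ E₁]
  {i A : E₁ →L[ℂ] E₀} {f g : ℝ → E₀} {u v : ℝ → E₁}

theorem MaxRegOn.eqOn_Icc {T C : ℝ} (h : MaxRegOn i A (Icc 0 T) C)
    (hu : IsSolOn i A (Icc 0 T) f u) (hv : IsSolOn i A (Icc 0 T) f v) (h0 : u 0 = v 0) :
    EqOn u v (Icc 0 T) := by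
  intro t ht
  have := h.bound_Icc (m := 0) (by rw [sub_self]; exact continuousOn_const) (hu.sub hv) (by simp) t ht
  simpa [h0, sub_eq_zero] using this

variable [CompleteSpace E₀] [CompleteSpace E₁]

/-- If `H' = μ H + g`, `H 0 = 0` and `H T` is large compared with `g` then `μ - A` is invertible. -/
theorem MaxRegOn.bijective {T C : ℝ} (h : MaxRegOn i A (Icc 0 T) C) (hT : 0 < T)
    {μ : ℂ} {H g : ℝ → ℂ} (hH : ∀ t, HasDerivAt H (μ * H t + g t) t) (H0 : H 0 = 0)
    (hg : Continuous g) {G : ℝ} (hG : ∀ t ∈ Icc 0 T, ‖g t‖ ≤ G) (hlt : C * ‖i‖ * G < ‖H T‖) :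
    Function.Bijective (μ • i - A) := by
  have hTT : T ∈ Icc 0 T := right_mem_Icc.2 hT.le
  have hG0 : 0 ≤ G := (norm_nonneg _).trans (hG T hTT)
  constructor
  · rw [injective_iff_map_eq_zero]
    intro x hx
    have hAx : A x = μ • i x := by
      have : μ • i x - A x = 0 := hx
      exact (sub_eq_zero.1 this).symm
    -- On an eigenvector the equation is scalar, so the estimate at `T` contradicts `hlt` unless `x
    -- = 0`.
    have hs : IsSolOn i A (Icc 0 T) (fun t => g t • i x) (fun t => H t • x) := by
      refine ⟨fun t _ => ((hH t).continuousAt.smul continuousAt_const).continuousWithinAt,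
        fun t _ => ?_⟩
      have := ((hH t).smul_const (i x)).hasDerivWithinAt (s := Icc 0 T)
      simp only [map_smul, hAx]
      refine this.congr_deriv ?_
      module
    have hb := h.bound_Icc (m := G * (‖i‖ * ‖x‖)) (by fun_prop) hs (fun t ht => by
      rw [norm_smul]
      exact mul_le_mul (hG t ht) (i.le_opNorm x) (norm_nonneg _) hG0) T hTT
    rw [norm_smul, H0, zero_smul, norm_zero, add_zero] at hb
    by_contra hne
    have := mul_lt_mul_of_pos_right hlt (norm_pos_iff.2 hne)
    linarith
  · have hex : ∀ y : E₀, ∃ u, IsSolOn i A (Icc 0 T) (fun t => g t • y) u ∧ u 0 = 0 :=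
      fun y => h.exists_Icc (by fun_prop) 0
    choose U hU hU0 using hex
    -- `K` sends `y` to the final value in `E₀` of the solution driven by `g y`; uniqueness makes it
    -- linear.
    let K : E₀ →L[ℂ] E₀ := LinearMap.mkContinuous
      { toFun := fun y => i (U y T)
        map_add' := fun y z => by
          rw [← map_add]
          congr 1
          refine h.eqOn_Icc (hU (y + z)) (((hU y).add (hU z)).congr (fun t _ => ?_)
            fun t _ => rfl) (by simp [hU0]) hTT
          simp [smul_add]
        map_smul' := fun c y => by
          rw [← map_smul]
          congr 1
          refine h.eqOn_Icc (hU (c • y)) (((hU y).const_smul c).congr (fun t _ => ?_)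
            fun t _ => rfl) (by simp [hU0]) hTT
          exact smul_comm _ _ _ } (C * ‖i‖ * G) fun y => by
        have hb := h.bound_Icc (m := G * ‖y‖) (by fun_prop) (hU y) (fun t ht => by
          rw [norm_smul]
          exact mul_le_mul_of_nonneg_right (hG t ht) (norm_nonneg _)) T hTT
        rw [hU0, norm_zero, add_zero] at hb
        calc ‖i (U y T)‖ ≤ ‖i‖ * (C * (G * ‖y‖)) := i.le_opNorm_of_le hb
          _ = _ := by ring
    have hK : ‖K‖ ≤ C * ‖i‖ * G :=
      LinearMap.mkContinuous_norm_le _ (mul_nonneg (mul_nonneg h.nonneg (norm_nonneg _)) hG0) _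
    have hHT : 0 < ‖H T‖ := (norm_nonneg K).trans_lt (hK.trans_lt hlt)
    have hne : H T ≠ 0 := norm_pos_iff.1 hHT
    have hun : IsUnit (1 - (H T)⁻¹ • K) := by
      refine isUnit_one_sub_of_norm_lt_one ?_
      rw [norm_smul, norm_inv, inv_mul_lt_iff₀ hHT, mul_one]
      exact hK.trans_lt hlt
    intro z
    obtain ⟨W, hW⟩ := hun.exists_right_inv
    set y := W ((H T)⁻¹ • z) with hy
    have hyz : H T • y - i (U y T) = z := by
      have h1 : y - (H T)⁻¹ • K y = (H T)⁻¹ • z :=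
        congrArg (fun V : E₀ →L[ℂ] E₀ => V ((H T)⁻¹ • z)) hW
      have h2 := congrArg (fun w => H T • w) h1
      simp only [smul_sub, smul_inv_smul₀ hne] at h2
      exact h2
    have hc : ContinuousOn (fun t : ℝ => Complex.exp (μ * (T - t)) • U y t) (Icc 0 T) :=
      ContinuousOn.smul (by fun_prop) (hU y).continuousOn
    have hci : IntervalIntegrable (fun t : ℝ => Complex.exp (μ * (T - t)) • U y t)
        MeasureTheory.volume 0 T := hc.intervalIntegrable_of_Icc hT.le
    -- Duhamel's formula: applying `μ - A` to the integrand gives the derivative of `exp (μ (T - t))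
    -- (H t y - U y t)`, which vanishes at `0` and equals `(H T - K) y = z` at `T`.
    refine ⟨∫ t in (0 : ℝ)..T, Complex.exp (μ * (T - t)) • U y t, ?_⟩
    rw [← ContinuousLinearMap.intervalIntegral_comp_comm _ hci]
    have hHc : Continuous H := continuous_iff_continuousAt.2 fun t => (hH t).continuousAt
    rw [intervalIntegral.integral_eq_sub_of_hasDerivAt_of_le hT.le
      (f := fun t : ℝ => Complex.exp (μ * (T - t)) • (H t • y - i (U y t)))]
    · simp [H0, hU0, hyz]
    · exact ContinuousOn.smul (by fun_prop)
        (ContinuousOn.sub (by fun_prop) (i.continuous.comp_continuousOn (hU y).continuousOn))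
    · intro t ht
      have h1 := ((hU y).hasDeriv t (Ioo_subset_Icc_self ht)).hasDerivAt (Icc_mem_nhds ht.1 ht.2)
      have h2 : HasDerivAt (fun t : ℝ => Complex.exp (μ * (T - t)))
          (Complex.exp (μ * (T - t)) * (-μ)) t := by
        have : HasDerivAt (fun t : ℝ => μ * ((T : ℂ) - t)) (-μ) t := by
          simpa using ((Complex.ofRealCLM.hasDerivAt (x := t)).const_sub (T : ℂ)).const_mul μ
        exact this.cexp
      refine (h2.smul (((hH t).smul_const y).sub h1)).congr_deriv ?_
      simp only [_root_.sub_apply, _root_.smul_apply, map_smul, Pi.sub_apply]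
      module
    · exact ((μ • i - A).continuous.comp_continuousOn hc).intervalIntegrable_of_Icc hT.le

/-- The open mapping theorem bounds the inverse of `μ - A` as a map into `E₁`, hence into `E₀`. -/
theorem mem_unboundedResolventSet (hi : Function.Injective i) {μ : ℂ}
    (h : Function.Bijective (μ • i - A)) : μ ∈ unboundedResolventSet (realization i hi A) := by
  let L := ContinuousLinearEquiv.ofBijective (μ • i - A) (LinearMap.ker_eq_bot.2 h.1)
    (LinearMap.range_eq_top.2 h.2)
  have hL : ∀ x, L x = μ • i x - A x := fun x => rfl
  refine ⟨i.comp (L.symm : E₀ →L[ℂ] E₁), ?_, fun y => ⟨⟨L.symm y, rfl⟩, ?_⟩⟩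
  · rintro ⟨_, x, rfl⟩
    have : realization i hi A ⟨i x, ⟨x, rfl⟩⟩ = A x := realization_apply i hi A x
    have e : L.symm (μ • i x - A x) = x := by rw [← hL, L.symm_apply_apply]
    exact (congrArg (fun z => i (L.symm (μ • i x - z))) this).trans (congrArg i e)
  · have : realization i hi A ⟨i (L.symm y), ⟨L.symm y, rfl⟩⟩ = A (L.symm y) :=
      realization_apply i hi A _
    refine (congrArg (fun z => μ • i (L.symm y) - z) this).trans ?_
    rw [← hL, L.apply_symm_apply]

/-- With `g = 1` one has `H T = (exp (μ T) - 1) / μ`, which outgrows the fixed constant `C ‖i‖` as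
`μ → ∞` along the reals. -/
theorem MaxRegOn.exists_bijective {T C : ℝ} (h : MaxRegOn i A (Icc 0 T) C) (hT : 0 < T) :
    ∃ μ : ℂ, Function.Bijective (μ • i - A) := by
  have key : Tendsto (fun x : ℝ => (Real.exp (x * T) - 1) / x) atTop atTop := by
    have h1 : Tendsto (fun x : ℝ => T * (Real.exp (x * T) / (x * T)) - 1) atTop atTop := by
      refine tendsto_atTop_add_const_right _ _ (Tendsto.const_mul_atTop hT ?_)
      have := (Real.tendsto_exp_div_pow_atTop 1).comp (tendsto_id.atTop_mul_const hT)
      simpa [Function.comp_def] using this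
    refine tendsto_atTop_mono' _ ?_ h1
    filter_upwards [eventually_ge_atTop 1] with x hx
    have : x ≠ 0 := by positivity
    have : T * (Real.exp (x * T) / (x * T)) - (Real.exp (x * T) - 1) / x = 1 / x := by
      field_simp
      ring
    have h2 : 1 / x ≤ 1 := by rw [div_le_one (by positivity)]; exact hx
    linarith
  obtain ⟨μ, h1, h2⟩ := ((key.eventually_gt_atTop (C * ‖i‖ * 1)).and (eventually_gt_atTop 0)).exists
  have hμ : (μ : ℂ) ≠ 0 := by exact_mod_cast h2.ne'
  refine ⟨μ, h.bijective hT (H := fun t => (Complex.exp (μ * t) - 1) / μ) (g := fun _ => 1)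
    (fun t => ?_) (by simp) continuous_const (G := 1) (by simp) ?_⟩
  · have : HasDerivAt (fun t : ℝ => (μ : ℂ) * t) μ t := by
      simpa using (Complex.ofRealCLM.hasDerivAt (x := t)).const_mul (μ : ℂ)
    refine ((this.cexp.sub_const 1).div_const (μ : ℂ)).congr_deriv ?_
    field_simp
    ring
  · refine h1.trans_le ((le_abs_self _).trans_eq ?_)
    rw [← Real.norm_eq_abs, ← Complex.norm_real]
    push_cast
    rfl

/-- Maximal regularity on the half line with a uniform constant gives a negative spectral bound. -/
theorem spectralBound_neg (hi : Function.Injective i) {C : ℝ}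
    (h : ∀ T, 0 < T → MaxRegOn i A (Icc 0 T) C) : spectralBound (realization i hi A) < 0 := by
  have hC : 0 ≤ C := (h 1 one_pos).nonneg
  -- Any `T > C ‖i‖` would do; the strict gap leaves room for a factor `exp (δ T)` with `δ > 0`.
  set T : ℝ := C * ‖i‖ + 1 with hTdef
  have hT : 0 < T := by positivity
  have hlim : Tendsto (fun δ : ℝ => C * ‖i‖ * Real.exp (δ * T)) (𝓝[>] 0) (𝓝 (C * ‖i‖)) := by
    have : Continuous (fun δ : ℝ => C * ‖i‖ * Real.exp (δ * T)) := by fun_prop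
    simpa using (this.tendsto 0).mono_left nhdsWithin_le_nhds
  obtain ⟨δ, hδ, hδ0⟩ := ((hlim.eventually_lt_const (show C * ‖i‖ < T by linarith)).and
    self_mem_nhdsWithin).exists
  have hδ0 : 0 < δ := hδ0
  have : spectralBound (realization i hi A) ≤ ((-δ : ℝ) : EReal) := by
    refine sSup_le ?_
    rintro _ ⟨μ, hμ, rfl⟩
    rw [EReal.coe_le_coe_iff]
    by_contra hlt
    push Not at hlt
    have hexp : ∀ t : ℝ, ‖Complex.exp (μ * t)‖ = Real.exp (μ.re * t) := fun t => by
      rw [Complex.norm_exp]; simp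
    -- Resonant forcing gains the factor `T`: `|H T| = T exp (Re μ T)`. The factor `exp (δ T)` in
    -- `G` covers negative `Re μ > -δ`, for which `|g|` is largest at `0`.
    refine hμ (mem_unboundedResolventSet hi ((h T hT).bijective hT
      (H := fun t => t * Complex.exp (μ * t)) (g := fun t => Complex.exp (μ * t))
      (fun t => ?_) (by simp) (by fun_prop) (G := Real.exp (μ.re * T) * Real.exp (δ * T)) ?_ ?_))
    · have h1 : HasDerivAt (fun t : ℝ => (t : ℂ)) 1 t := Complex.ofRealCLM.hasDerivAt
      have h2 : HasDerivAt (fun t : ℝ => μ * t) μ t := by simpa using h1.const_mul μ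
      refine (h1.mul h2.cexp).congr_deriv ?_
      ring
    · intro t ht
      rw [hexp, ← Real.exp_add]
      refine Real.exp_le_exp.2 ?_
      have h1 : 0 ≤ (μ.re + δ) * (T - t) :=
        mul_nonneg (by linarith) (by linarith [ht.2])
      have h2 : 0 ≤ δ * t := mul_nonneg hδ0.le ht.1
      nlinarith
    · rw [norm_mul, hexp, Complex.norm_real, Real.norm_eq_abs, abs_of_pos hT]
      have := mul_lt_mul_of_pos_right hδ (Real.exp_pos (μ.re * T))
      linarith
  refine this.trans_lt ?_
  exact_mod_cast neg_lt_zero.2 hδ0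

end Resolvent

/-! ### Holomorphic extension of a differentiable semigroup to a sector -/

section AnalyticExtension

variable {𝒜 : Type*} [NormedRing 𝒜] [NormedAlgebra ℂ 𝒜]

/-- A semigroup indexed by `(0, ∞)` in a Banach algebra, differentiable with derivative `D`. -/
structure IsDiffSemigroup (S D : ℝ → 𝒜) : Prop where
  map_add : ∀ s t, 0 < s → 0 < t → S (s + t) = S s * S t
  hasDerivAt : ∀ t, 0 < t → HasDerivAt S (D t) t

variable {S D : ℝ → 𝒜}

theorem IsDiffSemigroup.deriv_add (h : IsDiffSemigroup S D) {s t : ℝ} (hs : 0 < s) (ht : 0 < t) :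
    D (s + t) = D s * S t := by
  have h1 : HasDerivAt (fun r => S (r + t)) (D (s + t)) s :=
    (h.hasDerivAt (s + t) (by positivity)).comp_add_const s t
  have h2 : HasDerivAt (fun r => S r * S t) (D s * S t) s := (h.hasDerivAt s hs).mul_const _
  refine h1.unique (h2.congr_of_eventuallyEq ?_)
  filter_upwards [lt_mem_nhds hs] with r hr using h.map_add r t hr ht

/-- Each differentiation splits off one more factor: `D (t - n s) = D s * S (t - (n + 1) s)`. Fixing
`s` while `t` varies makes the formula for the `n`-th derivative differentiable. -/
theorem IsDiffSemigroup.hasDerivAt_iteratedDeriv_aux (h : IsDiffSemigroup S D) {n : ℕ}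
    (ih : ∀ t s : ℝ, 0 < s → n * s < t → iteratedDeriv n S t = D s ^ n * S (t - n * s))
    {s t : ℝ} (hs : 0 < s) (hst : (n + 1) * s < t) :
    HasDerivAt (iteratedDeriv n S) (D s ^ (n + 1) * S (t - (n + 1) * s)) t := by
  have h0 : (n : ℝ) * s + s < t := by linarith
  have h1 : HasDerivAt (fun r => D s ^ n * S (r - n * s)) (D s ^ n * D (t - n * s)) t := by
    refine HasDerivAt.const_mul _ ?_
    have := h.hasDerivAt (t - n * s) (by linarith)
    exact this.comp_sub_const t (n * s)
  have h2 : t - n * s = s + (t - (n + 1) * s) := by ring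
  rw [h2, h.deriv_add hs (by linarith), ← mul_assoc, ← pow_succ] at h1
  refine h1.congr_of_eventuallyEq ?_
  filter_upwards [lt_mem_nhds (show n * s < t by linarith)] with r hr using ih r s hs hr

theorem IsDiffSemigroup.iteratedDeriv_eq (h : IsDiffSemigroup S D) (n : ℕ) :
    ∀ t s : ℝ, 0 < s → n * s < t → iteratedDeriv n S t = D s ^ n * S (t - n * s) := by
  induction n with
  | zero => intro t s _ _; simp
  | succ n ih =>
    intro t s hs hst
    push_cast at hst ⊢
    rw [iteratedDeriv_succ]
    exact (h.hasDerivAt_iteratedDeriv_aux ih hs hst).deriv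

theorem IsDiffSemigroup.hasDerivAt_iteratedDeriv (h : IsDiffSemigroup S D) (n : ℕ) {t : ℝ}
    (ht : 0 < t) : HasDerivAt (iteratedDeriv n S) (iteratedDeriv (n + 1) S t) t := by
  have hs : 0 < t / (n + 2) := by positivity
  have hst : (n + 1) * (t / (n + 2)) < t := by
    rw [← mul_div_assoc, div_lt_iff₀ (by positivity)]
    nlinarith
  rw [h.iteratedDeriv_eq (n + 1) t _ hs (by push_cast; exact hst)]
  push_cast
  exact h.hasDerivAt_iteratedDeriv_aux (h.iteratedDeriv_eq n) hs hst

/-- The Taylor coefficients of `S` at `t`. -/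
noncomputable def taylorCoeff (S : ℝ → 𝒜) (n : ℕ) (t : ℝ) : 𝒜 :=
  (n.factorial : ℂ)⁻¹ • iteratedDeriv n S t

theorem IsDiffSemigroup.hasDerivAt_taylorCoeff (h : IsDiffSemigroup S D) (n : ℕ) {t : ℝ}
    (ht : 0 < t) :
    HasDerivAt (taylorCoeff S n) (((n : ℂ) + 1) • taylorCoeff S (n + 1) t) t := by
  refine ((h.hasDerivAt_iteratedDeriv n ht).const_smul ((n.factorial : ℂ)⁻¹)).congr_deriv ?_
  rw [taylorCoeff, smul_smul]
  congr 1
  have : (n.factorial : ℂ) ≠ 0 := by exact_mod_cast n.factorial_ne_zero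
  have h' : (n : ℂ) + 1 ≠ 0 := by exact_mod_cast n.succ_ne_zero
  rw [Nat.factorial_succ]
  push_cast
  field_simp

/-- Taking `s = t / (n + 1)` in `iteratedDeriv_eq` gives `n` factors of norm at most `M (n + 1) /
t`; the power `(n + 1) ^ n` is absorbed by the factorial. -/
theorem IsDiffSemigroup.norm_taylorCoeff_le (h : IsDiffSemigroup S D) {M : ℝ}
    (hS : ∀ t, 0 < t → ‖S t‖ ≤ M) (hD : ∀ t, 0 < t → t * ‖D t‖ ≤ M) (n : ℕ) {t : ℝ} (ht : 0 < t) :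
    ‖taylorCoeff S n t‖ ≤ M * Real.exp 1 * (M * Real.exp 1 / t) ^ n := by
  have hM : 0 ≤ M := (norm_nonneg _).trans (hS 1 one_pos)
  have h1 : ‖iteratedDeriv n S t‖ ≤ (M * (n + 1) / t) ^ n * M := by
    rcases Nat.eq_zero_or_pos n with rfl | hn
    · simpa using hS t ht
    have hs : 0 < t / (n + 1) := by positivity
    have e : t - n * (t / (n + 1)) = t / (n + 1) := by field_simp; ring
    rw [h.iteratedDeriv_eq n t (t / (n + 1)) hs (by
      rw [← mul_div_assoc, div_lt_iff₀ (by positivity)]; nlinarith), e]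
    refine (norm_mul_le _ _).trans (mul_le_mul ((norm_pow_le' _ hn).trans ?_) (hS _ hs)
      (norm_nonneg _) (by positivity))
    refine pow_le_pow_left₀ (norm_nonneg _) ?_ n
    have := hD _ hs
    rw [div_mul_eq_mul_div, div_le_iff₀ (by positivity)] at this
    rw [le_div_iff₀ ht]
    linarith
  have h2 : ((n : ℝ) + 1) ^ n / n.factorial ≤ Real.exp 1 * Real.exp 1 ^ n := by
    -- The exponent `n + 1` is used because `(n + 1) ^ (n + 1) / (n + 1)! = (n + 1) ^ n / n!`.
    have := Real.pow_div_factorial_le_exp ((n : ℝ) + 1) (by positivity) (n + 1)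
    rw [Nat.factorial_succ] at this
    push_cast at this
    rw [pow_succ', mul_div_mul_left _ _ (by positivity)] at this
    refine this.trans_eq ?_
    rw [← Real.exp_nat_mul, ← Real.exp_add]
    ring_nf
  rw [taylorCoeff, norm_smul, norm_inv, Complex.norm_natCast]
  calc (n.factorial : ℝ)⁻¹ * ‖iteratedDeriv n S t‖
      ≤ (n.factorial : ℝ)⁻¹ * ((M * (n + 1) / t) ^ n * M) := by gcongr
    _ = M * (M / t) ^ n * ((n + 1) ^ n / n.factorial) := by
        rw [mul_div_right_comm, mul_pow]; ring
    _ ≤ M * (M / t) ^ n * (Real.exp 1 * Real.exp 1 ^ n) := by gcongr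
    _ = _ := by rw [mul_div_right_comm, mul_pow]; ring

/-- The Taylor series of `S` based at `t`. -/
noncomputable def taylorExt (S : ℝ → 𝒜) (t : ℝ) (z : ℂ) : 𝒜 :=
  ∑' n, (z - t) ^ n • taylorCoeff S n t

theorem taylorExt_self (S : ℝ → 𝒜) (t : ℝ) : taylorExt S t t = S t := by
  rw [taylorExt, tsum_eq_single 0 (fun n hn => by simp [hn])]
  simp [taylorCoeff]

/-- Differentiating in the base point telescopes, leaving only the last term. -/
theorem IsDiffSemigroup.hasDerivAt_partialSum (h : IsDiffSemigroup S D) (z : ℂ) (N : ℕ) {t : ℝ}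
    (ht : 0 < t) :
    HasDerivAt (fun s : ℝ => ∑ n ∈ Finset.range (N + 1), (z - s) ^ n • taylorCoeff S n s)
      (((z - t) ^ N * ((N : ℂ) + 1)) • taylorCoeff S (N + 1) t) t := by
  induction N with
  | zero => simpa using h.hasDerivAt_taylorCoeff 0 ht
  | succ N ih =>
    simp only [Finset.sum_range_succ _ (N + 1)]
    have h1 : HasDerivAt (fun s : ℝ => (z - s) ^ (N + 1))
        (((N + 1 : ℕ) : ℂ) * (z - t) ^ N * (-1)) t := by
      have h0 : HasDerivAt (fun s : ℝ => z - (s : ℂ)) (-1) t :=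
        (Complex.ofRealCLM.hasDerivAt (x := t)).const_sub z
      simpa using h0.fun_pow (N + 1)
    refine (ih.add (h1.smul (h.hasDerivAt_taylorCoeff (N + 1) ht))).congr_deriv ?_
    push_cast
    module

section Bounds

variable {K : ℝ}

/-- The geometric bound on Taylor coefficients. -/
def TaylorBound (S : ℝ → 𝒜) (K : ℝ) : Prop :=
  ∀ (n : ℕ) (t : ℝ), 0 < t → ‖taylorCoeff S n t‖ ≤ K * (K / t) ^ n

theorem TaylorBound.norm_term_le (hK : 0 < K) (hb : TaylorBound S K) {t : ℝ} (ht : 0 < t) {z : ℂ}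
    (hz : 2 * K * ‖z - t‖ ≤ t) (n : ℕ) :
    ‖(z - t) ^ n • taylorCoeff S n t‖ ≤ K * (1 / 2) ^ n := by
  rw [norm_smul, norm_pow]
  calc ‖z - t‖ ^ n * ‖taylorCoeff S n t‖ ≤ ‖z - t‖ ^ n * (K * (K / t) ^ n) := by
        gcongr; exact hb n t ht
    _ = K * (‖z - t‖ * (K / t)) ^ n := by rw [mul_pow]; ring
    _ ≤ K * (1 / 2) ^ n := by
        gcongr
        rw [← mul_div_assoc, div_le_iff₀ ht]
        linarith

theorem summable_half (K : ℝ) : Summable fun n : ℕ => K * (1 / 2 : ℝ) ^ n :=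
  summable_geometric_two.mul_left K

theorem TaylorBound.norm_taylorExt_le (hK : 0 < K) (hb : TaylorBound S K) {t : ℝ} (ht : 0 < t)
    {z : ℂ} (hz : 2 * K * ‖z - t‖ ≤ t) : ‖taylorExt S t z‖ ≤ K * 2 :=
  tsum_of_norm_bounded (hasSum_geometric_two.mul_left K) (hb.norm_term_le hK ht hz)

variable [CompleteSpace 𝒜]

theorem TaylorBound.hasSum (hK : 0 < K) (hb : TaylorBound S K) {t : ℝ} (ht : 0 < t) {z : ℂ}
    (hz : 2 * K * ‖z - t‖ ≤ t) :
    HasSum (fun n => (z - t) ^ n • taylorCoeff S n t) (taylorExt S t z) :=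
  (Summable.of_norm_bounded (summable_half K) (hb.norm_term_le hK ht hz)).hasSum

/-- By `hasDerivAt_partialSum` and the mean value inequality, moving the base point along the
segment changes the partial sums by `O((N + 1) / 2 ^ N)`. The condition `2 K ‖z - s‖ ≤ s` survives
on the segment because it is convex in `s`. -/
theorem IsDiffSemigroup.taylorExt_eq (h : IsDiffSemigroup S D) (hK : 0 < K) (hb : TaylorBound S K)
    {t₀ t₁ : ℝ} (h₀ : 0 < t₀) (h₁ : 0 < t₁) {z : ℂ} (hz₀ : 2 * K * ‖z - t₀‖ ≤ t₀)
    (hz₁ : 2 * K * ‖z - t₁‖ ≤ t₁) : taylorExt S t₀ z = taylorExt S t₁ z := by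
  have hL : Tendsto (fun N : ℕ => (∑ n ∈ Finset.range (N + 1), (z - t₁) ^ n • taylorCoeff S n t₁) -
      ∑ n ∈ Finset.range (N + 1), (z - t₀) ^ n • taylorCoeff S n t₀) atTop
      (𝓝 (taylorExt S t₁ z - taylorExt S t₀ z)) :=
    (((hb.hasSum hK h₁ hz₁).tendsto_sum_nat.comp (tendsto_add_atTop_nat 1))).sub
      ((hb.hasSum hK h₀ hz₀).tendsto_sum_nat.comp (tendsto_add_atTop_nat 1))
  set m := min t₀ t₁ with hm
  have hm0 : 0 < m := lt_min h₀ h₁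
  have hseg : ∀ s ∈ segment ℝ t₀ t₁, m ≤ s ∧ 2 * K * ‖z - s‖ ≤ s := by
    rintro s ⟨a, b, ha, hb', hab, rfl⟩
    have e : z - ((a • t₀ + b • t₁ : ℝ) : ℂ) = (a : ℂ) * (z - t₀) + (b : ℂ) * (z - t₁) := by
      have : (a : ℂ) + b = 1 := by exact_mod_cast hab
      push_cast [smul_eq_mul]
      linear_combination (-z) * this
    have e2 : ‖z - ((a • t₀ + b • t₁ : ℝ) : ℂ)‖ ≤ a * ‖z - t₀‖ + b * ‖z - t₁‖ := by
      rw [e]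
      refine (norm_add_le _ _).trans ?_
      rw [norm_mul, norm_mul, Complex.norm_real, Complex.norm_real, Real.norm_of_nonneg ha,
        Real.norm_of_nonneg hb']
    refine ⟨?_, ?_⟩
    · have h3 := mul_le_mul_of_nonneg_left (min_le_left t₀ t₁) ha
      have h4 := mul_le_mul_of_nonneg_left (min_le_right t₀ t₁) hb'
      simp only [smul_eq_mul]
      have : m = a * m + b * m := by rw [← add_mul, hab, one_mul]
      rw [this]
      exact add_le_add h3 h4
    · refine (mul_le_mul_of_nonneg_left e2 (by positivity)).trans ?_
      have h3 := mul_le_mul_of_nonneg_left hz₀ ha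
      have h4 := mul_le_mul_of_nonneg_left hz₁ hb'
      simp only [smul_eq_mul]
      linarith
  have hbd : ∀ N : ℕ, ‖(∑ n ∈ Finset.range (N + 1), (z - t₁) ^ n • taylorCoeff S n t₁) -
      ∑ n ∈ Finset.range (N + 1), (z - t₀) ^ n • taylorCoeff S n t₀‖ ≤
      (((N : ℝ) + 1) * (1 / 2) ^ N) * (K * (K / m)) * ‖t₁ - t₀‖ := by
    intro N
    refine (convex_segment t₀ t₁).norm_image_sub_le_of_norm_hasDerivWithin_le
      (f := fun s : ℝ => ∑ n ∈ Finset.range (N + 1), (z - s) ^ n • taylorCoeff S n s)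
      (fun s hs => (h.hasDerivAt_partialSum z N (hm0.trans_le (hseg s hs).1)).hasDerivWithinAt)
      (fun s hs => ?_) (left_mem_segment _ _ _) (right_mem_segment _ _ _)
    obtain ⟨hs1, hs2⟩ := hseg s hs
    have hs0 : 0 < s := hm0.trans_le hs1
    rw [norm_smul, norm_mul, norm_pow]
    have e3 : ‖(N : ℂ) + 1‖ = N + 1 := by
      rw [← Nat.cast_add_one, Complex.norm_natCast]; push_cast; rfl
    rw [e3]
    have e4 : ‖z - s‖ * (K / s) ≤ 1 / 2 := by
      rw [← mul_div_assoc, div_le_iff₀ hs0]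
      linarith
    calc ‖z - s‖ ^ N * (N + 1) * ‖taylorCoeff S (N + 1) s‖
        ≤ ‖z - s‖ ^ N * (N + 1) * (K * (K / s) ^ (N + 1)) := by
          gcongr; exact hb _ _ hs0
      _ = ((N + 1) * (‖z - s‖ * (K / s)) ^ N) * (K * (K / s)) := by rw [mul_pow]; ring
      _ ≤ ((N + 1) * (1 / 2) ^ N) * (K * (K / m)) := by gcongr
  have hlim : Tendsto (fun N : ℕ => (((N : ℝ) + 1) * (1 / 2) ^ N) * (K * (K / m)) * ‖t₁ - t₀‖) atTop
      (𝓝 0) := by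
    have h1 := tendsto_self_mul_const_pow_of_lt_one (r := (1 / 2 : ℝ)) (by norm_num) (by norm_num)
    have h2 := tendsto_pow_atTop_nhds_zero_of_lt_one (r := (1 / 2 : ℝ)) (by norm_num) (by norm_num)
    have := ((h1.add h2).mul_const (K * (K / m))).mul_const ‖t₁ - t₀‖
    simpa [add_mul] using this
  have := tendsto_nhds_unique hL (squeeze_zero_norm hbd hlim)
  exact (sub_eq_zero.1 this).symm

/-- The open sector `|im z| < c re z`. -/
def slopeSector (c : ℝ) : Set ℂ := {z | 0 < z.re ∧ |z.im| < c * z.re}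

theorem isOpen_slopeSector (c : ℝ) : IsOpen (slopeSector c) :=
  (isOpen_lt continuous_const Complex.continuous_re).inter
    (isOpen_lt Complex.continuous_im.abs (Complex.continuous_re.const_mul c))

theorem convex_slopeSector (c : ℝ) : Convex ℝ (slopeSector c) := by
  rintro z ⟨hz, hz'⟩ w ⟨hw, hw'⟩ a b ha hb hab
  have key : ∀ x y : ℝ, 0 < x → 0 < y → 0 < a * x + b * y := by
    intro x y hx hy
    rcases ha.eq_or_lt with rfl | ha
    · rw [show b = 1 by linarith]; simpa
    · have := mul_pos ha hx
      have := mul_nonneg hb hy.le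
      linarith
  refine ⟨by simpa using key _ _ hz hw, ?_⟩
  rw [abs_lt] at *
  have h1 := key _ _ (sub_pos.2 hz'.1) (sub_pos.2 hw'.1)
  have h2 := key _ _ (sub_pos.2 hz'.2) (sub_pos.2 hw'.2)
  constructor <;> simp <;> linarith

theorem slopeSector_add {c : ℝ} {z w : ℂ} (hz : z ∈ slopeSector c) (hw : w ∈ slopeSector c) :
    z + w ∈ slopeSector c := by
  obtain ⟨hz, hz'⟩ := hz
  obtain ⟨hw, hw'⟩ := hw
  refine ⟨by simpa using add_pos hz hw, ?_⟩
  have := abs_add_le z.im w.im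
  simp only [Complex.add_im, Complex.add_re]
  linarith

theorem ofReal_mem_slopeSector {c t : ℝ} (hc : 0 < c) (ht : 0 < t) : (t : ℂ) ∈ slopeSector c :=
  ⟨by simpa, by simpa using mul_pos hc ht⟩

theorem norm_sub_re (z : ℂ) : ‖z - z.re‖ = |z.im| := by
  have : z - z.re = z.im * Complex.I := by
    apply Complex.ext <;> simp
  rw [this, norm_mul, Complex.norm_I, mul_one, Complex.norm_real, Real.norm_eq_abs]

theorem two_mul_le_of_mem_slopeSector (hK : 0 < K) {z : ℂ} (hz : z ∈ slopeSector (1 / (2 * K))) :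
    2 * K * ‖z - z.re‖ ≤ z.re := by
  rw [norm_sub_re]
  have := hz.2.le
  rw [one_div_mul_eq_div, le_div_iff₀ (by positivity)] at this
  linarith

/-- The base point `z.re` is not holomorphic in `z`, but near `z₀` it can be replaced by the fixed
`z₀.re`, and the series then converges uniformly. -/
theorem IsDiffSemigroup.differentiableOn_taylorExt (h : IsDiffSemigroup S D) (hK : 0 < K)
    (hb : TaylorBound S K) :
    DifferentiableOn ℂ (fun z => taylorExt S z.re z) (slopeSector (1 / (2 * K))) := by
  intro z₀ hz₀
  have hx : 0 < z₀.re := hz₀.1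
  set V : Set ℂ := {z | 2 * K * ‖z - z₀.re‖ < z₀.re}
  have hV : IsOpen V := isOpen_lt (by fun_prop) continuous_const
  have hzV : z₀ ∈ V := by
    have h2 := hz₀.2
    rw [one_div_mul_eq_div, lt_div_iff₀ (by positivity)] at h2
    simp only [V, mem_ofPred_eq, norm_sub_re]
    linarith
  have hd : DifferentiableOn ℂ (taylorExt S z₀.re) V :=
    Complex.differentiableOn_tsum_of_summable_norm (summable_half K)
      (fun n => by fun_prop) hV (fun n w hw => hb.norm_term_le hK hx (le_of_lt hw) n)
  refine ((hd.differentiableAt (hV.mem_nhds hzV)).congr_of_eventuallyEq ?_).differentiableWithinAt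
  filter_upwards [hV.mem_nhds hzV, (isOpen_slopeSector _).mem_nhds hz₀] with z hz hz'
  exact h.taylorExt_eq hK hb hz'.1 hx (two_mul_le_of_mem_slopeSector hK hz') (le_of_lt hz)

theorem eqOn_slopeSector_of_real {c : ℝ} (hc : 0 < c) {f g : ℂ → 𝒜}
    (hf : DifferentiableOn ℂ f (slopeSector c)) (hg : DifferentiableOn ℂ g (slopeSector c))
    (hfg : ∀ t : ℝ, 0 < t → f t = g t) : EqOn f g (slopeSector c) := by
  refine (hf.analyticOnNhd (isOpen_slopeSector c)).eqOn_of_preconnected_of_frequently_eq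
    (hg.analyticOnNhd (isOpen_slopeSector c)) (convex_slopeSector c).isPreconnected
    (ofReal_mem_slopeSector hc one_pos) ?_
  have h1 : Tendsto (fun t : ℝ => (t : ℂ)) (𝓝[≠] 1) (𝓝[≠] ((1 : ℝ) : ℂ)) := by
    refine tendsto_nhdsWithin_of_tendsto_nhds_of_eventually_within _
      (Complex.continuous_ofReal.continuousAt.tendsto.mono_left nhdsWithin_le_nhds) ?_
    filter_upwards [self_mem_nhdsWithin] with t ht
    simpa using ht
  have h2 : ∀ᶠ t : ℝ in 𝓝[≠] 1, f t = g t :=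
    (eventually_nhdsWithin_of_eventually_nhds (lt_mem_nhds one_pos)).mono hfg
  exact h1.frequently h2.frequently

/-- Analytic extension of a bounded semigroup with `‖t S'(t)‖` bounded. -/
theorem IsDiffSemigroup.exists_extension_of_bounded (h : IsDiffSemigroup S D) {M : ℝ}
    (hS : ∀ t, 0 < t → ‖S t‖ ≤ M) (hD : ∀ t, 0 < t → t * ‖D t‖ ≤ M) :
    ∃ c, 0 < c ∧ ∃ (Z : ℂ → 𝒜) (B : ℝ), (∀ t : ℝ, Z t = S t) ∧
      DifferentiableOn ℂ Z (slopeSector c) ∧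
      (∀ z ∈ slopeSector c, ∀ w ∈ slopeSector c, Z (z + w) = Z z * Z w) ∧
      ∀ z ∈ slopeSector c, ‖Z z‖ ≤ B := by
  set M' := max M 1
  have hM' : 0 < M' := lt_of_lt_of_le one_pos (le_max_right _ _)
  set K := M' * Real.exp 1
  have hK : 0 < K := by positivity
  have hb : TaylorBound S K := fun n t ht =>
    h.norm_taylorCoeff_le (fun t ht => (hS t ht).trans (le_max_left _ _))
      (fun t ht => (hD t ht).trans (le_max_left _ _)) n ht
  set c := 1 / (2 * K) with hcdef
  have hc : 0 < c := by positivity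
  set Z : ℂ → 𝒜 := fun z => taylorExt S z.re z with hZ
  have hZr : ∀ t : ℝ, Z t = S t := fun t => by simp [hZ, taylorExt_self]
  have hZd : DifferentiableOn ℂ Z (slopeSector c) := h.differentiableOn_taylorExt hK hb
  have hZs : ∀ w ∈ slopeSector c, DifferentiableOn ℂ (fun z => Z (z + w)) (slopeSector c) :=
    fun w hw => hZd.comp (by fun_prop) fun z hz => slopeSector_add hz hw
  refine ⟨c, hc, Z, K * 2, hZr, hZd, ?_, fun z hz =>
    hb.norm_taylorExt_le hK hz.1 (two_mul_le_of_mem_slopeSector hK hz)⟩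
  -- The semigroup law is continued in one variable at a time by the identity theorem: first `z`
  -- with `t` real, then `w`.
  have step : ∀ z ∈ slopeSector c, ∀ t : ℝ, 0 < t → Z (z + t) = Z z * Z t := by
    intro z hz t ht
    refine eqOn_slopeSector_of_real hc (hZs t (ofReal_mem_slopeSector hc ht)) (hZd.mul_const (Z t))
      (fun s hs => ?_) hz
    simp only [← Complex.ofReal_add, hZr, h.map_add s t hs ht]
  intro z hz w hw
  have := eqOn_slopeSector_of_real hc (hZs z hz) (hZd.const_mul (Z z))
    (fun s hs => by rw [add_comm]; exact step z hz s hs) hw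
  rw [add_comm]
  exact this

end Bounds

/-- Splitting `t` into steps of length `T` costs a factor `M` per step, giving the rate `log M / T`.
-/
theorem IsDiffSemigroup.exists_growth (h : IsDiffSemigroup S D) {T M : ℝ} (hT : 0 < T)
    (hM : 1 ≤ M) (hS : ∀ t, 0 < t → t ≤ T → ‖S t‖ ≤ M) :
    ∃ ω, 0 ≤ ω ∧ ∀ t, 0 < t → ‖S t‖ ≤ M * Real.exp (ω * t) := by
  have key : ∀ n : ℕ, ∀ t, 0 < t → t ≤ (n + 1) * T → ‖S t‖ ≤ M ^ (n + 1) := by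
    intro n
    induction n with
    | zero => intro t h0 h1; simpa using hS t h0 (by simpa using h1)
    | succ n ih =>
      intro t h0 h1
      push_cast at h1
      rcases le_or_gt t ((n + 1) * T) with h2 | h2
      · exact (ih t h0 h2).trans (pow_le_pow_right₀ hM (Nat.le_succ _))
      · have h3 : 0 < t - T := by
          have : 0 ≤ (n : ℝ) * T := by positivity
          linarith
        have e : S t = S T * S (t - T) := by rw [← h.map_add T _ hT h3]; congr 1; ring
        rw [e, pow_succ']
        exact (norm_mul_le _ _).trans (mul_le_mul (hS T hT le_rfl) (ih _ h3 (by linarith))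
          (norm_nonneg _) (by positivity))
  refine ⟨Real.log M / T, div_nonneg (Real.log_nonneg hM) hT.le, fun t ht => ?_⟩
  have h1 : t ≤ ((⌊t / T⌋₊ : ℝ) + 1) * T := by
    have := (Nat.lt_floor_add_one (t / T)).le
    rwa [div_le_iff₀ hT] at this
  refine (key _ t ht h1).trans ?_
  rw [pow_succ']
  refine mul_le_mul_of_nonneg_left ?_ (by positivity)
  rw [← Real.exp_log (show 0 < M ^ ⌊t / T⌋₊ by positivity), Real.log_pow, Real.exp_le_exp,
    div_mul_eq_mul_div, mul_div_assoc, mul_comm]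
  exact mul_le_mul_of_nonneg_left (Nat.floor_le (by positivity)) (Real.log_nonneg hM)

/-- Analytic extension of a semigroup with `S(t)` and `t S'(t)` bounded near `0`. -/
theorem IsDiffSemigroup.exists_extension [CompleteSpace 𝒜] (h : IsDiffSemigroup S D) {T M : ℝ}
    (hT : 0 < T) (hS : ∀ t, 0 < t → t ≤ T → ‖S t‖ ≤ M)
    (hD : ∀ t, 0 < t → t ≤ T → t * ‖D t‖ ≤ M) :
    ∃ c, 0 < c ∧ ∃ (Z : ℂ → 𝒜) (B a : ℝ), (∀ t : ℝ, Z t = S t) ∧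
      DifferentiableOn ℂ Z (slopeSector c) ∧
      (∀ z ∈ slopeSector c, ∀ w ∈ slopeSector c, Z (z + w) = Z z * Z w) ∧
      ∀ z ∈ slopeSector c, ‖Z z‖ ≤ B * Real.exp (a * z.re) := by
  wlog hM : 1 ≤ M generalizing M
  · exact this (fun t h0 h1 => (hS t h0 h1).trans (le_max_left M 1))
      (fun t h0 h1 => (hD t h0 h1).trans (le_max_left M 1)) (le_max_right M 1)
  obtain ⟨ω, hω, hg⟩ := h.exists_growth hT hM hS
  -- The extra `1` in the rate absorbs the factor `t ≤ exp t` in `t ‖D t‖` and `t ‖S t‖`.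
  set a := ω + 1 with ha
  have hD' : ∀ t, 0 < t → t * ‖D t‖ ≤ (M + M * M / T) * Real.exp (a * t) := by
    intro t ht
    have he : 1 ≤ Real.exp (a * t) := Real.one_le_exp (by positivity)
    rcases le_or_gt t T with h1 | h1
    · refine (hD t ht h1).trans ?_
      have : 0 ≤ M * M / T := by positivity
      nlinarith
    · have e : D t = D T * S (t - T) := by
        rw [← h.deriv_add hT (sub_pos.2 h1)]; congr 1; ring
      have h2 : ‖D T‖ ≤ M / T := by
        rw [le_div_iff₀ hT, mul_comm]; exact hD T hT le_rfl
      have h3 : ‖S (t - T)‖ ≤ M * Real.exp (ω * t) := by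
        refine (hg _ (sub_pos.2 h1)).trans ?_
        gcongr
        linarith
      have h4 : t ≤ Real.exp t := by linarith [Real.add_one_le_exp t]
      calc t * ‖D t‖ ≤ Real.exp t * ((M / T) * (M * Real.exp (ω * t))) := by
            rw [e]
            refine mul_le_mul h4 ((norm_mul_le _ _).trans ?_) (norm_nonneg _) (by positivity)
            exact mul_le_mul h2 h3 (norm_nonneg _) (by positivity)
        _ = M * M / T * (Real.exp t * Real.exp (ω * t)) := by ring
        _ = M * M / T * Real.exp (a * t) := by
            rw [← Real.exp_add, ha]; ring_nf
        _ ≤ _ := by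
            gcongr
            linarith
  have hte : ∀ t, 0 < t → t * ‖S t‖ ≤ M * Real.exp (a * t) := by
    intro t ht
    have h4 : t ≤ Real.exp t := by linarith [Real.add_one_le_exp t]
    calc t * ‖S t‖ ≤ Real.exp t * (M * Real.exp (ω * t)) :=
          mul_le_mul h4 (hg t ht) (norm_nonneg _) (by positivity)
      _ = M * (Real.exp t * Real.exp (ω * t)) := by ring
      _ = _ := by rw [← Real.exp_add, ha]; ring_nf
  set e : ℝ → ℂ := fun t => Complex.exp (-(a : ℂ) * t) with he
  have hne : ∀ t, ‖e t‖ = Real.exp (-a * t) := fun t => by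
    rw [he, Complex.norm_exp]; simp
  have hcancel : ∀ t, Real.exp (-a * t) * Real.exp (a * t) = 1 := fun t => by
    rw [← Real.exp_add]; simp
  have hder : ∀ t, HasDerivAt e (-(a : ℂ) * e t) t := fun t => by
    have : HasDerivAt (fun t : ℝ => -(a : ℂ) * t) (-(a : ℂ)) t := by
      simpa using (Complex.ofRealCLM.hasDerivAt (x := t)).const_mul (-(a : ℂ))
    exact this.cexp.congr_deriv (by ring)
  -- The damped semigroup `exp (-a t) S t` satisfies global bounds; its extension is multiplied back
  -- by `exp (a z)`.
  have h' : IsDiffSemigroup (fun t => e t • S t) (fun t => e t • (D t - (a : ℂ) • S t)) := by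
    refine ⟨fun s t hs ht => ?_, fun t ht => ?_⟩
    · simp only [h.map_add s t hs ht, he, smul_mul_smul_comm, ← Complex.exp_add]
      congr 2
      push_cast
      ring
    · refine ((hder t).smul (h.hasDerivAt t ht)).congr_deriv ?_
      module
  have hS' : ∀ t, 0 < t → ‖e t • S t‖ ≤ max M (M + M * M / T + a * M) := by
    intro t ht
    refine le_trans ?_ (le_max_left _ _)
    rw [norm_smul, hne]
    have h1 : ‖S t‖ ≤ M * Real.exp (a * t) := by
      refine (hg t ht).trans ?_
      gcongr
      linarith
    calc Real.exp (-a * t) * ‖S t‖ ≤ Real.exp (-a * t) * (M * Real.exp (a * t)) := by gcongr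
      _ = M * (Real.exp (-a * t) * Real.exp (a * t)) := by ring
      _ = M := by rw [hcancel, mul_one]
  have hD'' : ∀ t, 0 < t → t * ‖e t • (D t - (a : ℂ) • S t)‖ ≤ max M (M + M * M / T + a * M) := by
    intro t ht
    refine le_trans ?_ (le_max_right _ _)
    rw [norm_smul, hne]
    have h1 : t * ‖D t - (a : ℂ) • S t‖ ≤ (M + M * M / T + a * M) * Real.exp (a * t) := by
      have h2 : ‖D t - (a : ℂ) • S t‖ ≤ ‖D t‖ + a * ‖S t‖ := by
        refine (norm_sub_le _ _).trans_eq ?_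
        rw [norm_smul, Complex.norm_real, Real.norm_of_nonneg (by positivity)]
      have h3 := mul_le_mul_of_nonneg_left h2 ht.le
      have h4 := mul_le_mul_of_nonneg_left (hte t ht) (show 0 ≤ a by positivity)
      linarith [hD' t ht]
    calc t * (Real.exp (-a * t) * ‖D t - (a : ℂ) • S t‖)
        = Real.exp (-a * t) * (t * ‖D t - (a : ℂ) • S t‖) := by ring
      _ ≤ Real.exp (-a * t) * ((M + M * M / T + a * M) * Real.exp (a * t)) := by gcongr
      _ = (M + M * M / T + a * M) * (Real.exp (-a * t) * Real.exp (a * t)) := by ring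
      _ = _ := by rw [hcancel, mul_one]
  obtain ⟨c, hc, Z, B, hZr, hZd, hZm, hZb⟩ := h'.exists_extension_of_bounded hS' hD''
  have hcanc (z : ℂ) : Complex.exp (a * z) * Complex.exp (-a * z) = 1 := by
    rw [← Complex.exp_add]; simp
  refine ⟨c, hc, fun z => Complex.exp (a * z) • Z z, B, a, fun t => ?_, ?_,
    fun z hz w hw => ?_, fun z hz => ?_⟩
  · beta_reduce
    rw [hZr, smul_smul, he, hcanc, one_smul]
  · exact DifferentiableOn.smul (c := fun z => Complex.exp (a * z)) (by fun_prop) hZd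
  · simp only [hZm z hz w hw, smul_mul_smul_comm, ← Complex.exp_add, mul_add]
  · rw [norm_smul, Complex.norm_exp, mul_comm]
    simp only [Complex.mul_re, Complex.ofReal_re, Complex.ofReal_im, zero_mul, sub_zero]
    exact mul_le_mul_of_nonneg_right (hZb z hz) (Real.exp_pos _).le

/-- In the right half plane `tan (arg z) = im z / re z`, and `arctan` is strictly increasing. -/
theorem sector_arctan (c : ℝ) : sector (Real.arctan c) = slopeSector c := by
  have hlt : Real.arctan c < Real.pi / 2 := Real.arctan_lt_pi_div_two c
  ext z
  simp only [sector, slopeSector, mem_ofPred_eq]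
  constructor
  · rintro ⟨h0, hz⟩
    have hre : 0 < z.re := by
      have := Complex.abs_arg_lt_pi_div_two_iff.1 (hz.trans hlt)
      exact this.resolve_right h0
    refine ⟨hre, ?_⟩
    rw [← abs_of_pos hre, ← div_lt_iff₀ (abs_pos.2 hre.ne'), ← abs_div, ← Complex.tan_arg]
    rw [abs_lt] at hz ⊢
    have h1 : -(Real.pi / 2) < z.arg := by linarith
    have h2 : z.arg < Real.pi / 2 := by linarith
    rw [← Real.arctan_lt_arctan_iff (x := -c), ← Real.arctan_lt_arctan_iff (y := c), Real.arctan_tan h1 h2,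
      Real.arctan_neg]
    exact hz
  · rintro ⟨hre, hz⟩
    refine ⟨fun h => by simp [h] at hre, ?_⟩
    have harg := Complex.abs_arg_lt_pi_div_two_iff.2 (Or.inl hre)
    rw [← abs_of_pos hre, ← div_lt_iff₀ (abs_pos.2 hre.ne'), ← abs_div, ← Complex.tan_arg] at hz
    rw [abs_lt] at hz harg ⊢
    rw [← Real.arctan_lt_arctan_iff (x := -c), ← Real.arctan_lt_arctan_iff (y := c), Real.arctan_tan harg.1 harg.2,
      Real.arctan_neg] at hz
    exact hz

end AnalyticExtension

/-! ### The solution semigroup on `E₁` -/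

section HomogeneousProblem

variable {E₀ E₁ : Type*} [NormedAddCommGroup E₀] [NormedSpace ℂ E₀]
  [NormedAddCommGroup E₁] [NormedSpace ℂ E₁]
  {i A : E₁ →L[ℂ] E₀} {u v : ℝ → E₁}

theorem isSolOn_zero (J : Set ℝ) : IsSolOn i A J 0 0 :=
  ⟨continuousOn_const, fun t _ => by simpa using hasDerivWithinAt_const t J (0 : E₀)⟩

theorem IsSolOn.append {a b : ℝ} (ha : 0 ≤ a) (hb : 0 ≤ b) (hu : IsSolOn i A (Icc 0 a) 0 u)
    (hv : IsSolOn i A (Icc 0 b) 0 v) (huv : u a = v 0) :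
    ∃ w, IsSolOn i A (Icc 0 (a + b)) 0 w ∧ EqOn w u (Icc 0 a) := by
  have hv' := hv.comp_add_const (-a) (K := Icc a (a + b)) fun t ht =>
    ⟨by linarith [ht.1], by linarith [ht.2]⟩
  have := hu.glue hv' (fun t ht => ht.2) (fun t ht => ht.1) (right_mem_Icc.2 ha)
    (left_mem_Icc.2 (by linarith)) (by simp [huv]) rfl
  rw [Icc_union_Icc_eq_Icc ha (by linarith)] at this
  exact ⟨_, this.congr (fun t _ => by simp) fun t _ => rfl, eqOn_ite_left (fun t ht => ht.2) _ _⟩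

variable {T C : ℝ}

/-- The estimate is available on the full interval `[0, T]` only, so `u` is first continued past `τ`
by the solution starting at `u τ`. -/
theorem MaxRegOn.eqOn_zero_of_le (h : MaxRegOn i A (Icc 0 T) C) {τ : ℝ} (hτ : τ ≤ T)
    (hu : IsSolOn i A (Icc 0 τ) 0 u) (h0 : u 0 = 0) : EqOn u 0 (Icc 0 τ) := by
  intro t ht
  have hτ0 : 0 ≤ τ := ht.1.trans ht.2
  obtain ⟨v, hv, hv0⟩ := h.exists_Icc (f := 0) continuousOn_const (u τ)
  obtain ⟨w, hw, hwu⟩ := hu.append hτ0 (hτ0.trans hτ) hv hv0.symm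
  rw [← hwu ht]
  refine h.eqOn_Icc (hw.mono (Icc_subset_Icc_right (by linarith))) (isSolOn_zero _) ?_
    ⟨ht.1, ht.2.trans hτ⟩
  simp [hwu (left_mem_Icc.2 hτ0), h0]

theorem MaxRegOn.eqOn_zero (h : MaxRegOn i A (Icc 0 T) C) (hT : 0 < T) {τ : ℝ}
    (hu : IsSolOn i A (Icc 0 τ) 0 u) (h0 : u 0 = 0) : EqOn u 0 (Icc 0 τ) := by
  obtain ⟨k, hk⟩ := exists_nat_ge (τ / T)
  rw [div_le_iff₀ hT] at hk
  induction k generalizing τ u with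
  | zero => exact h.eqOn_zero_of_le (by simp at hk; linarith) hu h0
  | succ k ih =>
    have h1 : EqOn u 0 (Icc 0 (min τ T)) := h.eqOn_zero_of_le (min_le_right _ _)
      (hu.mono (Icc_subset_Icc_right (min_le_left _ _))) h0
    intro t ht
    rcases le_or_gt t T with h2 | h2
    · exact h1 ⟨ht.1, le_min ht.2 h2⟩
    · have h3 := hu.comp_add_const T (K := Icc 0 (τ - T)) fun s hs =>
        ⟨by linarith [hs.1], by linarith [hs.2]⟩
      have h4 : u (0 + T) = 0 := by
        rw [zero_add]
        exact h1 ⟨hT.le, le_min (h2.le.trans ht.2) le_rfl⟩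
      have h5 := ih h3 h4 (by push_cast at hk; linarith) (x := t - T)
        ⟨by linarith, by linarith [ht.2]⟩
      simpa using h5

theorem MaxRegOn.eqOn_of_homogeneous (h : MaxRegOn i A (Icc 0 T) C) (hT : 0 < T) {τ : ℝ}
    (hu : IsSolOn i A (Icc 0 τ) 0 u) (hv : IsSolOn i A (Icc 0 τ) 0 v) (h0 : u 0 = v 0) :
    EqOn u v (Icc 0 τ) := by
  intro t ht
  have := h.eqOn_zero hT ((hu.sub hv).congr (g := 0) (by simp [EqOn]) fun _ _ => rfl)
    (by simp [h0]) ht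
  exact sub_eq_zero.1 this

theorem MaxRegOn.exists_isSolOn_Icc (h : MaxRegOn i A (Icc 0 T) C) (hT : 0 < T) (x : E₁) (n : ℕ) :
    ∃ u, IsSolOn i A (Icc 0 (n * T)) 0 u ∧ u 0 = x := by
  induction n with
  | zero =>
    obtain ⟨u, hu, hx⟩ := h.exists_Icc (f := 0) continuousOn_const x
    exact ⟨u, hu.mono (Icc_subset_Icc_right (by simpa using hT.le)), hx⟩
  | succ n ih =>
    obtain ⟨u, hu, hx⟩ := ih
    obtain ⟨v, hv, hv0⟩ := h.exists_Icc (f := 0) continuousOn_const (u (n * T))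
    have hn : 0 ≤ (n : ℝ) * T := by positivity
    obtain ⟨w, hw, hwu⟩ := hu.append hn hT.le hv hv0.symm
    refine ⟨w, ?_, by rw [hwu (left_mem_Icc.2 hn), hx]⟩
    push_cast
    rwa [add_one_mul]

theorem isSolOn_Ici_of_forall_Icc {f : ℝ → E₀} (h : ∀ τ, IsSolOn i A (Icc 0 τ) f u) :
    IsSolOn i A (Ici 0) f u := by
  have hm (t : ℝ) (ht : t ∈ Ici (0 : ℝ)) : Icc 0 (t + 1) ∈ 𝓝[Ici 0] t := by
    rw [← Ici_inter_Iic]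
    exact inter_mem self_mem_nhdsWithin (mem_nhdsWithin_of_mem_nhds (Iic_mem_nhds (by linarith)))
  refine ⟨fun t ht => ?_, fun t ht => ?_⟩
  · exact ((h (t + 1)).continuousOn t ⟨ht, by linarith⟩).mono_of_mem_nhdsWithin (hm t ht)
  · exact ((h (t + 1)).hasDeriv t ⟨ht, by linarith⟩).mono_of_mem_nhdsWithin (hm t ht)

theorem MaxRegOn.exists_isSolOn_Ici (h : MaxRegOn i A (Icc 0 T) C) (hT : 0 < T) (x : E₁) :
    ∃ u, IsSolOn i A (Ici 0) 0 u ∧ u 0 = x := by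
  choose U hU hU0 using h.exists_isSolOn_Icc hT x
  have hle (t : ℝ) : t ≤ (⌈t / T⌉₊ : ℝ) * T := by
    rw [← div_le_iff₀ hT]
    exact Nat.le_ceil _
  -- Solutions on the intervals `[0, n T]` agree on overlaps by uniqueness, so at each `t` any
  -- interval containing it may be used.
  refine ⟨fun t => U ⌈t / T⌉₊ t, isSolOn_Ici_of_forall_Icc fun τ => ?_, hU0 _⟩
  refine ((hU ⌈τ / T⌉₊).mono (Icc_subset_Icc_right (hle τ))).congr (fun _ _ => rfl) fun t ht => ?_
  exact h.eqOn_of_homogeneous hT ((hU _).mono (Icc_subset_Icc_right (hle t)))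
    ((hU _).mono (Icc_subset_Icc_right (ht.2.trans (hle τ)))) (by rw [hU0, hU0]) ⟨ht.1, le_rfl⟩

/-- The family of solution operators of `u' = A u` in `E₁`. -/
structure IsSolutionFamily (i A : E₁ →L[ℂ] E₀) (S : ℝ → E₁ →L[ℂ] E₁) : Prop where
  isSolOn : ∀ x, IsSolOn i A (Ici 0) 0 fun t => S t x
  map_zero : S 0 = 1
  unique : ∀ u : ℝ → E₁, IsSolOn i A (Ici 0) 0 u → ∀ t, 0 ≤ t → u t = S t (u 0)
  locally_bounded : ∀ τ, ∃ K, ∀ t ∈ Icc 0 τ, ‖S t‖ ≤ K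

theorem MaxRegOn.exists_solutionFamily (h : MaxRegOn i A (Icc 0 T) C) (hT : 0 < T) :
    ∃ S, IsSolutionFamily i A S := by
  choose U hU hU0 using h.exists_isSolOn_Ici hT
  have huniq {u v : ℝ → E₁} (hu : IsSolOn i A (Ici 0) 0 u) (hv : IsSolOn i A (Ici 0) 0 v)
      (h0 : u 0 = v 0) {t : ℝ} (ht : 0 ≤ t) : u t = v t :=
    h.eqOn_of_homogeneous hT (hu.mono Icc_subset_Ici_self) (hv.mono Icc_subset_Ici_self) h0
      ⟨ht, le_rfl⟩
  -- Bounds in `E₁` propagate by restarting at `T`: the first step costs `C`, the remaining time is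
  -- covered by induction.
  have hbd : ∀ k : ℕ, ∃ K, 0 ≤ K ∧ ∀ t ∈ Icc 0 (k * T), ∀ x, ‖U x t‖ ≤ K * ‖x‖ := by
    intro k
    induction k with
    | zero =>
      refine ⟨1, zero_le_one, fun t ht x => ?_⟩
      obtain rfl : t = 0 := by simpa using ht
      simp [hU0]
    | succ k ih =>
      obtain ⟨K, hK0, hK⟩ := ih
      have h1 : ∀ t ∈ Icc 0 T, ∀ x, ‖U x t‖ ≤ C * ‖x‖ := fun t ht x => by
        have := h.bound_Icc (m := 0) continuousOn_const ((hU x).mono Icc_subset_Ici_self)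
          (fun _ _ => (norm_zero (E := E₀)).le) t ht
        simpa [hU0] using this
      refine ⟨max C (K * C), le_max_of_le_left h.nonneg, fun t ht x => ?_⟩
      rcases le_or_gt t T with h2 | h2
      · refine (h1 t ⟨ht.1, h2⟩ x).trans ?_
        gcongr
        exact le_max_left _ _
      · have hs := (hU x).comp_add_const T (K := Ici 0) fun s hs =>
          mem_Ici.2 (add_nonneg hs hT.le)
        have e : U x t = U (U x T) (t - T) := by
          have := huniq hs (hU (U x T)) (by simp [hU0]) (sub_nonneg.2 h2.le)
          simpa using this
        rw [e]
        calc ‖U (U x T) (t - T)‖ ≤ K * ‖U x T‖ := hK _ ⟨by linarith, by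
              have := ht.2
              push_cast at this
              linarith⟩ _
          _ ≤ K * (C * ‖x‖) := by
              gcongr
              exact h1 T ⟨hT.le, le_rfl⟩ x
          _ = K * C * ‖x‖ := by ring
          _ ≤ _ := by
              gcongr
              exact le_max_right _ _
  have hbd' : ∀ τ, ∃ K, 0 ≤ K ∧ ∀ t ∈ Icc 0 τ, ∀ x, ‖U x t‖ ≤ K * ‖x‖ := fun τ => by
    obtain ⟨k, hk⟩ := exists_nat_ge (τ / T)
    rw [div_le_iff₀ hT] at hk
    obtain ⟨K, hK0, hK⟩ := hbd k
    exact ⟨K, hK0, fun t ht => hK t ⟨ht.1, ht.2.trans hk⟩⟩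
  have hadd (t : ℝ) (ht : 0 ≤ t) (x y : E₁) : U (x + y) t = U x t + U y t :=
    huniq (hU _) (((hU x).add (hU y)).congr (g := 0) (by simp [EqOn]) fun _ _ => rfl)
      (by simp [hU0]) ht
  have hsmul (t : ℝ) (ht : 0 ≤ t) (c : ℂ) (x : E₁) : U (c • x) t = c • U x t :=
    huniq (hU _) (((hU x).const_smul c).congr (g := 0) (by simp [EqOn]) fun _ _ => rfl)
      (by simp [hU0]) ht
  have hex : ∀ t : ℝ, ∃ S : E₁ →L[ℂ] E₁, 0 ≤ t → ∀ x, S x = U x t := by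
    intro t
    by_cases ht : 0 ≤ t
    · obtain ⟨K, -, hK⟩ := hbd' t
      exact ⟨LinearMap.mkContinuous ⟨⟨fun x => U x t, hadd t ht⟩, hsmul t ht⟩ K
        (hK t ⟨ht, le_rfl⟩), fun _ _ => rfl⟩
    · exact ⟨0, fun h => absurd h ht⟩
  choose S hS using hex
  refine ⟨S, fun x => (hU x).congr (fun _ _ => rfl) fun t ht => hS t ht x, ?_, fun u hu t ht => ?_,
    fun τ => ?_⟩
  · ext x
    rw [hS 0 le_rfl, hU0, one_apply_eq_self]
  · rw [hS t ht]
    exact huniq hu (hU _) (hU0 _).symm ht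
  · obtain ⟨K, hK0, hK⟩ := hbd' τ
    exact ⟨K, fun t ht => ContinuousLinearMap.opNorm_le_bound _ hK0 fun x => by
      rw [hS t ht.1]
      exact hK t ht x⟩

namespace IsSolutionFamily

variable {S : ℝ → E₁ →L[ℂ] E₁}

theorem map_add (hS : IsSolutionFamily i A S) {s t : ℝ} (hs : 0 ≤ s) (ht : 0 ≤ t) :
    S (s + t) = S s * S t := by
  ext x
  have h1 := (hS.isSolOn x).comp_add_const t (K := Ici 0) fun s hs => mem_Ici.2 (add_nonneg hs ht)
  have := hS.unique _ h1 s hs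
  simpa using this

/-- An operator intertwined with `A` maps solutions to solutions, so uniqueness forces it to commute
with `S t`. -/
theorem commute (hS : IsSolutionFamily i A S) {R : E₁ →L[ℂ] E₁} {R₀ : E₀ →L[ℂ] E₀}
    (hR : ∀ x, i (R x) = R₀ (i x)) (hRA : ∀ x, A (R x) = R₀ (A x)) {t : ℝ} (ht : 0 ≤ t) (x : E₁) :
    S t (R x) = R (S t x) := by
  have h1 : IsSolOn i A (Ici 0) 0 fun t => R (S t x) := by
    refine ⟨R.continuous.comp_continuousOn (hS.isSolOn x).continuousOn, fun s hs => ?_⟩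
    have := (R₀.restrictScalars ℝ).hasFDerivAt.comp_hasDerivWithinAt s
      ((hS.isSolOn x).hasDeriv s hs)
    simp only [hR, hRA]
    simpa [Function.comp_def] using this
  have := hS.unique _ h1 t ht
  rw [this, hS.map_zero, one_apply_eq_self]

end IsSolutionFamily

end HomogeneousProblem

/-! ### The semigroup on `E₀`: generator, smoothing and analyticity -/

section Generation

variable {E₀ E₁ : Type*} [NormedAddCommGroup E₀] [NormedSpace ℂ E₀]
  [NormedAddCommGroup E₁] [NormedSpace ℂ E₁]
  {i A : E₁ →L[ℂ] E₀}

theorem opNorm_le_of_denseRange {F : Type*} [NormedAddCommGroup F] [NormedSpace ℂ F]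
    (hd : DenseRange i) (B : E₀ →L[ℂ] F) {c : ℝ} (hc : 0 ≤ c) (h : ∀ x, ‖B (i x)‖ ≤ c * ‖i x‖) :
    ‖B‖ ≤ c := by
  refine B.opNorm_le_bound hc fun y => ?_
  exact hd.induction_on (p := fun y => ‖B y‖ ≤ c * ‖y‖) y
    (isClosed_le (by fun_prop) (by fun_prop)) h

theorem eq_of_denseRange {F : Type*} [NormedAddCommGroup F] [NormedSpace ℂ F]
    (hd : DenseRange i) {B B' : E₀ →L[ℂ] F} (h : ∀ x, B (i x) = B' (i x)) : B = B' := by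
  ext y
  exact hd.induction_on (p := fun y => B y = B' y) y
    (isClosed_eq (by fun_prop) (by fun_prop)) h

/-- A family of bounded operators on `E₀` that restricts to a solution family on `E₁` and is similar
to it. -/
structure IsExtendedFamily (i A : E₁ →L[ℂ] E₀) (S : ℝ → E₁ →L[ℂ] E₁) (S₀ : ℝ → E₀ →L[ℂ] E₀)
    (L : E₁ ≃L[ℂ] E₀) (μ : ℂ) : Prop where
  family : IsSolutionFamily i A S
  equiv_apply : ∀ x, L x = μ • i x - A x
  eq_conj : ∀ t y, S₀ t y = L (S t (L.symm y))

theorem exists_extendedFamily [CompleteSpace E₀] [CompleteSpace E₁] {S : ℝ → E₁ →L[ℂ] E₁}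
    (hS : IsSolutionFamily i A S) {μ : ℂ} (hμ : Function.Bijective (μ • i - A)) :
    ∃ S₀ L, IsExtendedFamily i A S S₀ L μ := by
  let L := ContinuousLinearEquiv.ofBijective (μ • i - A) (LinearMap.ker_eq_bot.2 hμ.1)
    (LinearMap.range_eq_top.2 hμ.2)
  exact ⟨fun t => (L : E₁ →L[ℂ] E₀).comp ((S t).comp (L.symm : E₀ →L[ℂ] E₁)), L, hS,
    fun x => rfl, fun t y => rfl⟩

namespace IsExtendedFamily

variable {S : ℝ → E₁ →L[ℂ] E₁} {S₀ : ℝ → E₀ →L[ℂ] E₀} {L : E₁ ≃L[ℂ] E₀} {μ : ℂ}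

theorem apply_symm (h : IsExtendedFamily i A S S₀ L μ) (y : E₀) :
    A (L.symm y) = μ • i (L.symm y) - y := by
  have := h.equiv_apply (L.symm y)
  rw [L.apply_symm_apply] at this
  nth_rewrite 3 [this]
  abel

/-- Since `A = μ - L` on `E₁`, the resolvent `L⁻¹` intertwines with `A`, hence commutes with `S t`,
and the conjugation by `L` cancels. -/
theorem apply_incl (h : IsExtendedFamily i A S S₀ L μ) {t : ℝ} (ht : 0 ≤ t) (x : E₁) :
    S₀ t (i x) = i (S t x) := by
  have h1 : ∀ x, A (L.symm (i x)) = i (L.symm (A x)) := by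
    intro x
    have e : A x = μ • i x - L x := by rw [h.equiv_apply]; abel
    rw [h.apply_symm, e, map_sub, map_sub, L.symm_apply_apply, map_smul, map_smul]
  have h2 := h.family.commute (R := (L.symm : E₀ →L[ℂ] E₁).comp i)
    (R₀ := i.comp (L.symm : E₀ →L[ℂ] E₁)) (fun x => rfl) h1 ht x
  rw [h.eq_conj]
  refine (congrArg L h2).trans ?_
  exact L.apply_symm_apply _

theorem map_zero (h : IsExtendedFamily i A S S₀ L μ) : S₀ 0 = 1 := by
  ext y
  rw [h.eq_conj, h.family.map_zero, one_apply_eq_self, L.apply_symm_apply, one_apply_eq_self]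

theorem map_add (h : IsExtendedFamily i A S S₀ L μ) {s t : ℝ} (hs : 0 ≤ s) (ht : 0 ≤ t) :
    S₀ (s + t) = S₀ s * S₀ t := by
  ext y
  rw [mul_apply_eq_comp, h.eq_conj, h.eq_conj, h.eq_conj, h.family.map_add hs ht,
    L.symm_apply_apply, mul_apply_eq_comp]

theorem continuousOn (h : IsExtendedFamily i A S S₀ L μ) (y : E₀) :
    ContinuousOn (fun t => S₀ t y) (Ici 0) := by
  simp only [h.eq_conj]
  exact L.continuous.comp_continuousOn (h.family.isSolOn _).continuousOn

theorem norm_le (h : IsExtendedFamily i A S S₀ L μ) (t : ℝ) :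
    ‖S₀ t‖ ≤ ‖(L : E₁ →L[ℂ] E₀)‖ * ‖S t‖ * ‖(L.symm : E₀ →L[ℂ] E₁)‖ := by
  have : S₀ t = ((L : E₁ →L[ℂ] E₀).comp (S t)).comp (L.symm : E₀ →L[ℂ] E₁) := by
    ext y
    exact h.eq_conj t y
  rw [this]
  refine (ContinuousLinearMap.opNorm_comp_le _ _).trans ?_
  gcongr
  exact ContinuousLinearMap.opNorm_comp_le _ _

theorem isC0Semigroup (h : IsExtendedFamily i A S S₀ L μ) :
    IsC0Semigroup fun t : ℝ≥0 => S₀ t := by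
  refine ⟨h.map_zero, fun s t => ?_, fun x => ?_⟩
  · push_cast
    exact h.map_add s.2 t.2
  · exact (h.continuousOn x).comp_continuous NNReal.continuous_coe fun t => t.2

theorem tendsto_coe_nhdsGT : Tendsto (fun t : ℝ≥0 => (t : ℝ)) (𝓝[>] 0) (𝓝[>] 0) := by
  refine tendsto_nhdsWithin_of_tendsto_nhds_of_eventually_within _ ?_ ?_
  · exact (NNReal.continuous_coe.tendsto 0).mono_left nhdsWithin_le_nhds
  · filter_upwards [self_mem_nhdsWithin] with t ht
    exact NNReal.coe_pos.2 ht

theorem tendsto_diffQuotient (h : IsExtendedFamily i A S S₀ L μ) (x : E₁) :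
    Tendsto (fun t : ℝ≥0 => (t : ℝ)⁻¹ • (S₀ t (i x) - i x)) (𝓝[>] 0) (𝓝 (A x)) := by
  have h1 := (h.family.isSolOn x).hasDeriv 0 self_mem_Ici
  rw [h.family.map_zero] at h1
  have h2 := (hasDerivWithinAt_iff_tendsto_slope.1 h1).comp
    (tendsto_coe_nhdsGT.mono_right (nhdsWithin_mono _ (t := Ici 0 \ {0}) fun t ht =>
      ⟨le_of_lt (mem_Ioi.1 ht), ne_of_gt (mem_Ioi.1 ht)⟩))
  simp only [one_apply_eq_self, Pi.zero_apply, add_zero] at h2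
  refine h2.congr fun t => ?_
  simp only [Function.comp_apply, slope_def_module, sub_zero, h.apply_incl t.coe_nonneg,
    h.family.map_zero, one_apply_eq_self]

theorem isInfinitesimalGenerator (h : IsExtendedFamily i A S S₀ L μ) (hi : Function.Injective i) :
    IsInfinitesimalGenerator (realization i hi A) fun t : ℝ≥0 => S₀ t := by
  intro x y
  rw [LinearPMap.mem_graph_iff]
  constructor
  · rintro ⟨⟨_, z, rfl⟩, hx, hy⟩
    obtain rfl : i z = x := hx
    have e : realization i hi A ⟨i z, ⟨z, rfl⟩⟩ = A z := realization_apply i hi A z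
    obtain rfl : A z = y := e.symm.trans hy
    exact h.tendsto_diffQuotient z
  · intro hxy
    have h1 := h.tendsto_diffQuotient (L.symm x)
    -- The resolvent is applied to the difference quotients: the limit is the resolvent of `y`, and
    -- also `A (L⁻¹ x)` because `L⁻¹ x` lies in `E₁`. Equating the two exhibits `x` as the image of
    -- `w`.
    have h2 := ((i.continuous.comp L.symm.continuous).tendsto y).comp hxy
    have h3 : A (L.symm x) = i (L.symm y) := by
      refine tendsto_nhds_unique h1 (h2.congr fun t => ?_)
      have e : S t (L.symm x) = L.symm (S₀ t x) := by rw [h.eq_conj, L.symm_apply_apply]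
      simp only [Function.comp_apply]
      rw [h.apply_incl t.coe_nonneg, e]
      exact ((i.comp (L.symm : E₀ →L[ℂ] E₁)).map_smul_of_tower (t : ℝ)⁻¹ _).trans
        (congrArg _ (map_sub (i.comp (L.symm : E₀ →L[ℂ] E₁)) _ _))
    set w := μ • L.symm x - L.symm y with hw
    have h4 : i w = x := by
      rw [h.apply_symm] at h3
      rw [hw, _root_.map_sub, map_smul, ← h3]
      abel
    have h5 : A w = y := by
      have := h.tendsto_diffQuotient w
      rw [h4] at this
      exact tendsto_nhds_unique this hxy
    exact ⟨⟨i w, ⟨w, rfl⟩⟩, h4, (realization_apply i hi A w).trans h5⟩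

theorem locally_bounded (h : IsExtendedFamily i A S S₀ L μ) (τ : ℝ) :
    ∃ K, 0 ≤ K ∧ ∀ t ∈ Icc 0 τ, ‖S₀ t‖ ≤ K := by
  obtain ⟨K, hK⟩ := h.family.locally_bounded τ
  refine ⟨‖(L : E₁ →L[ℂ] E₀)‖ * max K 0 * ‖(L.symm : E₀ →L[ℂ] E₁)‖, by positivity, fun t ht => ?_⟩
  refine (h.norm_le t).trans ?_
  gcongr
  exact (hK t ht).trans (le_max_left _ _)

/-- The smoothing estimate, obtained by applying maximal regularity to `t ↦ t S(t) x`. -/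
theorem smoothing (h : IsExtendedFamily i A S S₀ L μ) {T C : ℝ}
    (hC : MaxRegOn i A (Icc 0 T) C) :
    ∃ K, 0 ≤ K ∧ ∀ t ∈ Icc 0 T, ∀ x, t * ‖S t x‖ ≤ K * ‖i x‖ := by
  obtain ⟨K, hK0, hK⟩ := h.locally_bounded T
  refine ⟨C * K, mul_nonneg hC.nonneg hK0, fun t ht x => ?_⟩
  have hx := (h.family.isSolOn x).mono (Icc_subset_Ici_self (a := T) (b := 0))
  -- The product rule turns the weight `t` into the forcing `S t x`, which is controlled in `E₀`
  -- alone, while the initial value becomes `0`.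
  have hs : IsSolOn i A (Icc 0 T) (fun t => i (S t x)) (fun t => (t : ℂ) • S t x) := by
    refine ⟨ContinuousOn.smul (by fun_prop) hx.continuousOn, fun s hs => ?_⟩
    have h1 := (Complex.ofRealCLM.hasDerivAt (x := s)).hasDerivWithinAt (s := Icc 0 T)
    have := h1.smul (hx.hasDeriv s hs)
    simpa [Pi.smul_def'] using this
  have hb := hC.bound_Icc (m := K * ‖i x‖) (i.continuous.comp_continuousOn hx.continuousOn) hs
    (fun s hs => by
      rw [Function.comp_apply, ← h.apply_incl hs.1]
      exact (S₀ s).le_of_opNorm_le (hK s hs) _) t ht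
  rw [norm_smul, Complex.norm_real, Real.norm_of_nonneg ht.1, Complex.ofReal_zero, zero_smul,
    norm_zero, add_zero, ← mul_assoc] at hb
  exact hb

/-- Smoothing bounds `A S(t)` by the `E₀` norm, so it extends from the dense subspace `E₁` to `E₀`.
-/
theorem exists_derivative [CompleteSpace E₀] (h : IsExtendedFamily i A S S₀ L μ) {T C : ℝ}
    (hd : DenseRange i) (hT : 0 < T) (hC : MaxRegOn i A (Icc 0 T) C) :
    ∃ (D : ℝ → E₀ →L[ℂ] E₀) (M : ℝ), (∀ t, 0 < t → ∀ x, D t (i x) = A (S t x)) ∧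
      ∀ t, 0 < t → t ≤ T → t * ‖D t‖ ≤ M := by
  obtain ⟨K, hK0, hK⟩ := h.smoothing hC
  have hsmall : ∀ t, 0 < t → t ≤ T → ∀ x, ‖A (S t x)‖ ≤ ‖A‖ * K / t * ‖i x‖ := by
    intro t ht htT x
    have h1 := hK t ⟨ht.le, htT⟩ x
    have h2 : ‖S t x‖ ≤ K * ‖i x‖ / t := by rw [le_div_iff₀ ht]; linarith
    exact (A.le_opNorm_of_le h2).trans_eq (by ring)
  -- Past `T`, smoothing is applied over a time `min t T` and the rest is carried by the bounded `S`
  -- on `E₁`.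
  have hall : ∀ t, 0 < t → ∃ c, ∀ x, ‖A (S t x)‖ ≤ c * ‖i x‖ := by
    intro t ht
    set s := min t T
    have hs : 0 < s := lt_min ht hT
    refine ⟨‖A‖ * ‖S (t - s)‖ * (K / s), fun x => ?_⟩
    have e : S t x = S (t - s) (S s x) := by
      rw [← mul_apply_eq_comp,
        ← h.family.map_add (sub_nonneg.2 (min_le_left _ _)) hs.le, sub_add_cancel]
    have h1 := hK s ⟨hs.le, min_le_right _ _⟩ x
    have h2 : ‖S s x‖ ≤ K * ‖i x‖ / s := by rw [le_div_iff₀ hs]; linarith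
    rw [e]
    exact (A.le_opNorm_of_le ((S (t - s)).le_opNorm_of_le h2)).trans_eq (by ring)
  have hex : ∀ t : ℝ, ∃ D : E₀ →L[ℂ] E₀, 0 < t → ∀ x, D (i x) = A (S t x) := by
    intro t
    by_cases ht : 0 < t
    · exact ⟨((A.comp (S t) : E₁ →L[ℂ] E₀) : E₁ →ₗ[ℂ] E₀).extendOfNorm (i : E₁ →ₗ[ℂ] E₀),
        fun _ x => LinearMap.extendOfNorm_eq hd (hall t ht) x⟩
    · exact ⟨0, fun h => absurd h ht⟩
  choose D hD using hex
  refine ⟨D, ‖A‖ * K, hD, fun t ht htT => ?_⟩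
  have := opNorm_le_of_denseRange hd (D t) (c := ‖A‖ * K / t) (by positivity) fun x => by
    rw [hD t ht]
    exact hsmall t ht htT x
  rwa [le_div_iff₀ ht, mul_comm] at this

theorem hasDerivAt_incl (h : IsExtendedFamily i A S S₀ L μ) {D : ℝ → E₀ →L[ℂ] E₀}
    (hD : ∀ t, 0 < t → ∀ x, D t (i x) = A (S t x)) {t : ℝ} (ht : 0 < t) (x : E₁) :
    HasDerivAt (fun s => S₀ s (i x)) (D t (i x)) t := by
  have h1 := ((h.family.isSolOn x).hasDeriv t ht.le).hasDerivAt (Ici_mem_nhds ht)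
  rw [hD t ht]
  simp only [Pi.zero_apply, add_zero] at h1
  refine h1.congr_of_eventuallyEq ?_
  filter_upwards [lt_mem_nhds ht] with s hs using h.apply_incl hs.le x

theorem derivative_add (h : IsExtendedFamily i A S S₀ L μ) (hd : DenseRange i)
    {D : ℝ → E₀ →L[ℂ] E₀} (hD : ∀ t, 0 < t → ∀ x, D t (i x) = A (S t x)) {s t : ℝ} (hs : 0 < s)
    (ht : 0 ≤ t) : D (s + t) = D s * S₀ t := by
  refine eq_of_denseRange hd fun x => ?_
  rw [hD _ (by positivity), mul_apply_eq_comp, h.apply_incl ht, hD s hs,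
    h.family.map_add hs.le ht, mul_apply_eq_comp]

/-- The mean value inequality on orbits from `E₁`, with constants relative to `‖i x‖`, passes to the
operator norm by density. `B = 0` gives a Lipschitz bound and `B = D t` gives differentiability. -/
theorem norm_sub_sub_le (h : IsExtendedFamily i A S S₀ L μ) (hd : DenseRange i)
    {D : ℝ → E₀ →L[ℂ] E₀} (hD : ∀ t, 0 < t → ∀ x, D t (i x) = A (S t x)) {s : Set ℝ}
    (hs : Convex ℝ s) (hs0 : ∀ t ∈ s, 0 < t) {B : E₀ →L[ℂ] E₀} {c : ℝ} (hc : 0 ≤ c)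
    (hB : ∀ t ∈ s, ‖D t - B‖ ≤ c) {t r : ℝ} (ht : t ∈ s) (hr : r ∈ s) :
    ‖S₀ r - S₀ t - (r - t) • B‖ ≤ c * ‖r - t‖ := by
  refine opNorm_le_of_denseRange hd _ (by positivity) fun x => ?_
  have h1 : ∀ q ∈ s, HasDerivWithinAt (fun q => S₀ q (i x) - q • B (i x))
      (D q (i x) - B (i x)) s q := fun q hq => by
    have := (h.hasDerivAt_incl hD (hs0 q hq) x).sub ((hasDerivAt_id q).smul_const (B (i x)))
    simpa [Pi.sub_def] using this.hasDerivWithinAt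
  have h2 := hs.norm_image_sub_le_of_norm_hasDerivWithin_le (C := c * ‖i x‖) h1 (fun q hq =>
    (D q - B).le_of_opNorm_le (hB q hq) (i x)) ht hr
  have e : (S₀ r - S₀ t - (r - t) • B) (i x) =
      S₀ r (i x) - r • B (i x) - (S₀ t (i x) - t • B (i x)) := by
    simp only [_root_.sub_apply, _root_.smul_apply]
    module
  rw [e]
  linarith

/-- Local boundedness of `D` makes `S₀` norm continuous; the factorization `D r = D (t / 2) * S₀ (r
- t / 2)` then makes `D` norm continuous, and `norm_sub_sub_le` with `B = D t` concludes. -/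
theorem hasDerivAt (h : IsExtendedFamily i A S S₀ L μ) (hd : DenseRange i)
    {D : ℝ → E₀ →L[ℂ] E₀} (hD : ∀ t, 0 < t → ∀ x, D t (i x) = A (S t x)) {t : ℝ} (ht : 0 < t) :
    HasDerivAt S₀ (D t) t := by
  have hcont : ∀ t, 0 < t → ContinuousAt S₀ t := by
    intro t ht
    obtain ⟨K, hK0, hK⟩ := h.locally_bounded (2 * t)
    have hb : ∀ r ∈ Ioo (t / 2) (2 * t), ‖D r - 0‖ ≤ ‖D (t / 2)‖ * K := fun r hr => by
      have e : D r = D (t / 2) * S₀ (r - t / 2) := by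
        rw [← h.derivative_add hd hD (by positivity) (by linarith [hr.1])]; congr 1; ring
      rw [sub_zero, e]
      refine (norm_mul_le _ _).trans ?_
      gcongr
      exact hK _ ⟨by linarith [hr.1], by linarith [hr.2]⟩
    have htm : t ∈ Ioo (t / 2) (2 * t) := ⟨by linarith, by linarith⟩
    have hLip : ∀ r ∈ Ioo (t / 2) (2 * t), ‖S₀ r - S₀ t‖ ≤ ‖D (t / 2)‖ * K * ‖r - t‖ :=
      fun r hr => by
        simpa using h.norm_sub_sub_le hd hD (convex_Ioo _ _)
          (fun q hq => lt_trans (by positivity) hq.1) (by positivity) hb htm hr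
    rw [ContinuousAt, tendsto_iff_norm_sub_tendsto_zero]
    have hlim : Tendsto (fun r => ‖D (t / 2)‖ * K * ‖r - t‖) (𝓝 t) (𝓝 0) := by
      have : Continuous fun r : ℝ => ‖D (t / 2)‖ * K * ‖r - t‖ := by fun_prop
      simpa using this.tendsto t
    refine squeeze_zero' (Eventually.of_forall fun _ => norm_nonneg _) ?_ hlim
    filter_upwards [Ioo_mem_nhds htm.1 htm.2] with r hr using hLip r hr
  have hDc : ContinuousAt D t := by
    have h1 : ContinuousAt (fun r => D (t / 2) * S₀ (r - t / 2)) t := by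
      refine continuousAt_const.mul (ContinuousAt.comp (g := S₀) ?_ (by fun_prop))
      exact hcont _ (by linarith)
    refine h1.congr ?_
    filter_upwards [lt_mem_nhds (show t / 2 < t by linarith)] with r hr
    rw [← h.derivative_add hd hD (by positivity) (by linarith)]
    congr 1
    ring
  rw [hasDerivAt_iff_isLittleO, Asymptotics.isLittleO_iff]
  intro ε hε
  obtain ⟨δ, hδ, hball⟩ := Metric.mem_nhds_iff.1 (inter_mem (lt_mem_nhds ht)
    (hDc.preimage_mem_nhds (Metric.closedBall_mem_nhds _ hε)))
  filter_upwards [Metric.ball_mem_nhds t hδ] with r hr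
  exact h.norm_sub_sub_le hd hD (convex_ball t δ) (fun q hq => (hball hq).1) hε.le
    (fun q hq => by simpa [dist_eq_norm] using (hball hq).2) (Metric.mem_ball_self hδ) hr

theorem isAnalyticSemigroup [CompleteSpace E₀] (h : IsExtendedFamily i A S S₀ L μ) {T C : ℝ}
    (hd : DenseRange i) (hT : 0 < T) (hC : MaxRegOn i A (Icc 0 T) C) :
    IsAnalyticSemigroup fun t : ℝ≥0 => S₀ t := by
  obtain ⟨D, M, hD, hDM⟩ := h.exists_derivative hd hT hC
  obtain ⟨K, -, hK⟩ := h.locally_bounded T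
  have hs : IsDiffSemigroup S₀ D := ⟨fun s t hs ht => h.map_add hs.le ht.le,
    fun t ht => h.hasDerivAt hd hD ht⟩
  obtain ⟨c, hc, Z, B, a, hZr, hZd, hZm, hZb⟩ := hs.exists_extension (M := max M K) hT
    (fun t ht htT => (hK t ⟨ht.le, htT⟩).trans (le_max_right _ _))
    (fun t ht htT => (hDM t ht htT).trans (le_max_left _ _))
  have hsec := sector_arctan c
  refine ⟨Real.arctan c, Real.arctan_pos.2 hc, (Real.arctan_lt_pi_div_two c).le, Z,
    fun t => hZr t, hsec ▸ hZd, hsec ▸ hZm, fun θ hθ hθc x => ?_⟩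
  have hsub : sector θ ⊆ slopeSector c := by
    rw [← hsec]
    exact fun z hz => ⟨hz.1, hz.2.trans hθc⟩
  refine Tendsto.mono_left ?_ (nhdsWithin_mono _ hsub)
  have hB : ∀ᶠ z in 𝓝[slopeSector c] 0, ‖Z z‖ ≤ |B| + 1 := by
    have h1 : Tendsto (fun z : ℂ => |B| * Real.exp (a * z.re)) (𝓝[slopeSector c] 0) (𝓝 |B|) := by
      have : Continuous fun z : ℂ => |B| * Real.exp (a * z.re) := by fun_prop
      simpa using (this.tendsto 0).mono_left nhdsWithin_le_nhds
    filter_upwards [h1.eventually_lt_const (lt_add_one _), self_mem_nhdsWithin] with z hz hz'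
    refine (hZb z hz').trans (le_trans ?_ hz.le)
    gcongr
    exact le_abs_self B
  rw [Metric.tendsto_nhds]
  intro ε hε
  set b := |B| + 1
  have hb : 0 < b := by positivity
  have hx : Tendsto (fun t => S₀ t x) (𝓝[>] 0) (𝓝 x) := by
    have := (h.continuousOn x 0 self_mem_Ici).tendsto
    rw [h.map_zero, one_apply_eq_self] at this
    exact this.mono_left (nhdsWithin_mono _ Ioi_subset_Ici_self)
  obtain ⟨s, hs1, hs0⟩ := ((Metric.tendsto_nhds.1 hx (ε / (2 * (b + 1))) (by positivity)).and
    self_mem_nhdsWithin).exists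
  have hs0 : 0 < s := hs0
  have hsm : (s : ℂ) ∈ slopeSector c := ofReal_mem_slopeSector hc hs0
  have hc1 : Tendsto (fun z : ℂ => Z (z + s) x) (𝓝[slopeSector c] 0) (𝓝 (S₀ s x)) := by
    have h1 : ContinuousAt Z s :=
      (hZd.differentiableAt ((isOpen_slopeSector c).mem_nhds hsm)).continuousAt
    have h2 : ContinuousAt (fun z : ℂ => Z (z + s)) 0 :=
      ContinuousAt.comp (g := Z) (by simpa using h1) (by fun_prop)
    have h3 := (h2.clm_apply (continuousAt_const (y := x))).tendsto
    rw [zero_add, hZr] at h3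
    exact h3.mono_left nhdsWithin_le_nhds
  filter_upwards [hB, self_mem_nhdsWithin, Metric.tendsto_nhds.1 hc1 (ε / 2) (by positivity)]
    with z hz hz' hz''
  -- As `Z` is known to be continuous only inside the sector, `x` is replaced by the nearby `S₀ s
  -- x`, on which `Z z` acts as `Z (z + s)`; the two errors are paid for by the bound `b` on `Z z`
  -- and by `1`.
  have e : Z z x - x = Z z (x - S₀ s x) + (Z (z + s) x - S₀ s x) + (S₀ s x - x) := by
    rw [hZm z hz' s hsm, mul_apply_eq_comp, hZr, _root_.map_sub]
    abel
  rw [dist_eq_norm] at hs1 hz'' ⊢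
  rw [e]
  have h1 : ‖Z z (x - S₀ s x)‖ ≤ b * ‖S₀ s x - x‖ := by
    rw [norm_sub_rev (S₀ s x) x]
    exact (Z z).le_of_opNorm_le hz _
  have h2 : (b + 1) * ‖S₀ s x - x‖ < ε / 2 := by
    have := mul_lt_mul_of_pos_left hs1 (show 0 < b + 1 by positivity)
    refine this.trans_eq ?_
    field_simp
  have h3 := norm_add₃_le (a := Z z (x - S₀ s x)) (b := Z (z + s) x - S₀ s x) (c := S₀ s x - x)
  linarith

end IsExtendedFamily

theorem MaxRegOn.generatesAnalyticSemigroup [CompleteSpace E₀] [CompleteSpace E₁] {T C : ℝ}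
    (h : MaxRegOn i A (Icc 0 T) C) (hT : 0 < T) (hi : Function.Injective i) (hd : DenseRange i) :
    GeneratesAnalyticSemigroup (realization i hi A) := by
  obtain ⟨S, hS⟩ := h.exists_solutionFamily hT
  obtain ⟨μ, hμ⟩ := h.exists_bijective hT
  obtain ⟨S₀, L, hS₀⟩ := exists_extendedFamily hS hμ
  exact ⟨_, hS₀.isC0Semigroup, hS₀.isInfinitesimalGenerator hi, hS₀.isAnalyticSemigroup hd hT h⟩

end Generation
end ContMaxReg

theorem theorem1 {E₀ E₁ : Type*}
    [NormedAddCommGroup E₀] [NormedSpace ℂ E₀] [CompleteSpace E₀]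
    [NormedAddCommGroup E₁] [NormedSpace ℂ E₁] [CompleteSpace E₁]
    (i : E₁ →L[ℂ] E₀) (hi : Function.Injective i) (hdense : DenseRange i)
    (A : E₁ →L[ℂ] E₀) (hclosed : (ContMaxReg.realization i hi A).IsClosed) :
    (∀ (T : ℝ) (hT : 0 < T),
      ContMaxReg.IsPairOfContMaxReg i A (Set.Icc 0 T) (Set.left_mem_Icc.2 hT.le) →
        ContMaxReg.GeneratesAnalyticSemigroup (ContMaxReg.realization i hi A)) ∧
    (ContMaxReg.IsPairOfContMaxReg i A (Set.Ici 0) Set.self_mem_Ici →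
        ContMaxReg.GeneratesAnalyticSemigroup (ContMaxReg.realization i hi A) ∧
        ContMaxReg.spectralBound (ContMaxReg.realization i hi A) < 0) := by
  refine ⟨fun T hT h => ?_, fun h => ?_⟩
  · obtain ⟨C, hC⟩ := h.maxRegOn _ hi
    exact hC.generatesAnalyticSemigroup hT hi hdense
  · obtain ⟨C, hC⟩ := h.maxRegOn _ hi
    exact ⟨(hC.Icc_of_Ici one_pos).generatesAnalyticSemigroup one_pos hi hdense,
      ContMaxReg.spectralBound_neg hi fun T hT => hC.Icc_of_Ici hT⟩
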